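/- Let $G$ be a simple graph with vertex set $\{1,\dots,n\}$ and $m\ge 1$ edges, accessible through degree queries (the answer is $d(v)$) and neighbor queries (the answer is the $i$-th neighbor of $v$ in an arbitrary fixed order for $1\le i\le d(v)$, and a special symbol otherwise). Let $\alpha\in\mathbb R$ and $\epsilon,\delta\in(0,1)$. An edge is called high if both of its endpoints have degree larger than $2\alpha/\epsilon$. An almost uniform edge sampler with accuracy $\eta$ is a randomized query algorithm $S$ that, given $n$, $\eta$ and $\delta'\in(0,1)$, halts with probability $1$, returning an edge of $G$ or the message that no edge is returned, such that an edge is returned with probability at least $1-\delta'$ and each edge is returned with probability in $[(1-\eta)/m,(1+\eta)/m]$. The procedure Estimate-high-edges$(n,\alpha,\epsilon,\delta)$ uses such a sampler $S$ with accuracy $0.1$. It sets $r=\lceil 100\lceil\log_2(2/\delta)\rceil/\epsilon\rceil$ and $\delta'=\delta/(2r)$. It invokes $S(n,0.1,\delta')$ up to $r$ times, and if some invocation returns no edge, it returns FEW. Otherwise it determines by degree queries the fraction $\chi$ of the $r$ returned edges that are high. It returns MANY if $\chi>2.6\epsilon$, and FEW otherwise. (a) For every almost uniform edge sampler $S$ with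 accuracy $0.1$, the procedure returns, with probability $1$, a value in $\{\text{MANY},\text{FEW}\}$, and: 1. if $G$ has more than $4\epsilon m$ high edges, then it returns MANY with probability at least $1-\delta$; 2. if $G$ has at most $2\epsilon m$ high edges, then it returns FEW with probability at least $1-\delta$. (b) There is an almost uniform edge sampler $S$ with accuracy $0.1$ whose expected query complexity and running time are at most $C\,\frac{n}{\sqrt{0.1\,m}}\,(1+\log n)^k(1+\log(1/\delta'))^k$ for some constants $C,k$, and for which the expected query complexity and running time of Estimate-high-edges are $$\tilde O\Big(\frac{n}{\sqrt m}\cdot\frac{\log(1/\epsilon)}{\epsilon}\Big)\cdot\mathrm{poly}(\log(1/\delta)),$$ that is, at most $C'\,\frac{n}{\sqrt m}\cdot\frac{1+\log(1/\epsilon)}{\epsilon}\,(1+\log n)^{k'}(1+\log(1/\delta))^{k'}$ for constants $C',k'$ that do not depend on $G,n,\alpha,\epsilon,\delta$. Algorithms are finite programs over real-valued registers with unit-cost arithmetic operations, comparisons, draws of uniform random integers, and queries. -/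

import Mathlib

open scoped ENNReal

noncomputable section

/-! ### Query access to a graph -/

/-- A simple graph on `n` vertices together with an arbitrary ordering of the neighbors of each
vertex (its incidence lists). -/
structure QueryGraph (n : ℕ) where
  graph : SimpleGraph (Fin n)
  nbr : (v : Fin n) → Fin (graph.neighborSet v).ncard ≃ graph.neighborSet v

namespace QueryGraph

variable {n : ℕ}

/-- The degree `d(v)`. -/
def deg (Q : QueryGraph n) (v : Fin n) : ℕ := (Q.graph.neighborSet v).ncard

/-- The number `m` of edges. -/
def numEdges (Q : QueryGraph n) : ℕ := Q.graph.edgeSet.ncard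

/-- The number of high edges: edges both of whose endpoints have degree above `2α/ε`. -/
def numHighEdges (Q : QueryGraph n) (α ε : ℝ) : ℕ :=
  {e ∈ Q.graph.edgeSet | ∀ v ∈ e, 2 * α / ε < (Q.deg v : ℝ)}.ncard

end QueryGraph

/-- Algorithms refer to the `n` vertices by the numbers `1, …, n`. -/
def vertexLabel {n : ℕ} (v : Fin n) : ℝ := (v : ℝ) + 1

open Classical in
/-- The vertex that a number refers to, if there is one. -/
def vertexAt (n : ℕ) (x : ℝ) : Option (Fin n) :=
  if h : ∃ v : Fin n, vertexLabel v = x then some h.choose else none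

/-- Answer to a degree query (`0` if `x` does not denote a vertex). -/
def QueryGraph.degAnswer {n : ℕ} (Q : QueryGraph n) (x : ℝ) : ℝ :=
  match vertexAt n x with
  | some v => Q.deg v
  | none => 0

open Classical in
/-- Answer to the query for the `y`-th neighbor of `x`, where `1 ≤ y ≤ d(x)`; any other query is
answered by the special symbol `0`, which is not the label of a vertex. -/
def QueryGraph.nbrAnswer {n : ℕ} (Q : QueryGraph n) (x y : ℝ) : ℝ :=
  match vertexAt n x with
  | some v =>
      if h : ∃ i : Fin (Q.graph.neighborSet v).ncard, (i : ℝ) + 1 = y then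
        vertexLabel (Q.nbr v h.choose : Fin n)
      else 0
  | none => 0

/-! ### Randomized query algorithms and their running time

Algorithms are finite programs over registers of type `ρ` that hold real numbers. There are no
operations besides the four arithmetic operations, comparison, drawing a uniform integer, and the
two kinds of queries, each at unit cost. -/

/-- Contents of the registers. -/
abbrev Store (ρ : Type) := ρ → ℝ

/-- Elementary instructions; the first argument is the register that is written. -/
inductive Instr (ρ : Type) where
  | const (x : ρ) (c : ℚ)
  | copy (x y : ρ)
  | add (x y z : ρ)
  | sub (x y z : ρ)
  | mul (x y z : ρ)
  | div (x y z : ρ)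
  /-- a uniformly random element of `{1, …, k}`, where `k` is the integer part of register `y` -/
  | rand (x y : ρ)
  /-- degree query on the vertex in register `y` -/
  | degree (x y : ρ)
  /-- query for the neighbor number `z` of the vertex in register `y` -/
  | neighbor (x y z : ρ)

/-- Programs. -/
inductive Prog (ρ : Type) where
  | skip
  | op (i : Instr ρ)
  | seq (a b : Prog ρ)
  /-- if `x < y` then `a` else `b` -/
  | ite (x y : ρ) (a b : Prog ρ)
  /-- while `x < y` do `a` -/
  | loop (x y : ρ) (a : Prog ρ)

/-- Renaming of the registers of an instruction. -/
def Instr.map {ρ ρ' : Type} (f : ρ → ρ') : Instr ρ → Instr ρ'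
  | const x c => const (f x) c
  | copy x y => copy (f x) (f y)
  | add x y z => add (f x) (f y) (f z)
  | sub x y z => sub (f x) (f y) (f z)
  | mul x y z => mul (f x) (f y) (f z)
  | div x y z => div (f x) (f y) (f z)
  | rand x y => rand (f x) (f y)
  | degree x y => degree (f x) (f y)
  | neighbor x y z => neighbor (f x) (f y) (f z)

/-- Renaming of the registers of a program. -/
def Prog.map {ρ ρ' : Type} (f : ρ → ρ') : Prog ρ → Prog ρ'
  | skip => skip
  | op i => op (i.map f)
  | seq a b => seq (a.map f) (b.map f)
  | ite x y a b => ite (f x) (f y) (a.map f) (b.map f)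
  | loop x y a => loop (f x) (f y) (a.map f)

/-- Sequential composition of a list of programs. -/
def Prog.block {ρ : Type} : List (Prog ρ) → Prog ρ
  | [] => skip
  | c :: cs => seq c (block cs)

/-- The number of queries (`0` or `1`) that an instruction makes. -/
def Instr.queries {ρ : Type} : Instr ρ → ℕ
  | degree _ _ => 1
  | neighbor _ _ _ => 1
  | _ => 0

/-- A uniformly random element of `{1, …, k}` (and `0` if `k = 0`). -/
def uniformUpTo (k : ℕ) : PMF ℝ :=
  match k with
  | 0 => PMF.pure 0
  | j + 1 => (PMF.uniformOfFintype (Fin (j + 1))).map fun i => (i : ℝ) + 1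

section Semantics

variable {n : ℕ} {ρ : Type} [DecidableEq ρ]

/-- The effect of one instruction on the store. -/
def Instr.eval (Q : QueryGraph n) (σ : Store ρ) : Instr ρ → PMF (Store ρ)
  | const x c => PMF.pure (Function.update σ x (c : ℝ))
  | copy x y => PMF.pure (Function.update σ x (σ y))
  | add x y z => PMF.pure (Function.update σ x (σ y + σ z))
  | sub x y z => PMF.pure (Function.update σ x (σ y - σ z))
  | mul x y z => PMF.pure (Function.update σ x (σ y * σ z))
  | div x y z => PMF.pure (Function.update σ x (σ y / σ z))
  | rand x y => (uniformUpTo ⌊σ y⌋₊).map fun r => Function.update σ x r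
  | degree x y => PMF.pure (Function.update σ x (Q.degAnswer (σ y)))
  | neighbor x y z => PMF.pure (Function.update σ x (Q.nbrAnswer (σ y) (σ z)))

/-- A configuration: the programs that remain to be executed (first one first), the store, and the
number of queries made so far. -/
structure Config (ρ : Type) where
  stack : List (Prog ρ)
  store : Store ρ
  queries : ℕ

open Classical in
/-- One step of execution. A configuration with empty stack has halted. -/
def step (Q : QueryGraph n) : Config ρ → PMF (Config ρ)
  | ⟨[], σ, q⟩ => PMF.pure ⟨[], σ, q⟩
  | ⟨.skip :: K, σ, q⟩ => PMF.pure ⟨K, σ, q⟩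
  | ⟨.op i :: K, σ, q⟩ => (i.eval Q σ).map fun σ' => ⟨K, σ', q + i.queries⟩
  | ⟨.seq a b :: K, σ, q⟩ => PMF.pure ⟨a :: b :: K, σ, q⟩
  | ⟨.ite x y a b :: K, σ, q⟩ => PMF.pure ⟨(if σ x < σ y then a else b) :: K, σ, q⟩
  | ⟨.loop x y a :: K, σ, q⟩ =>
      PMF.pure ⟨if σ x < σ y then a :: .loop x y a :: K else K, σ, q⟩

/-- The distribution of the configuration after `t` steps. -/
def runSteps (Q : QueryGraph n) (c : Config ρ) : ℕ → PMF (Config ρ)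
  | 0 => PMF.pure c
  | t + 1 => (runSteps Q c t).bind (step Q)

/-- The initial configuration of program `P` with store `σ`. -/
def Prog.start (P : Prog ρ) (σ : Store ρ) : Config ρ := ⟨[P], σ, 0⟩

/-- The probability that `P`, started with store `σ`, halts with a store in `A`. -/
def haltProb (Q : QueryGraph n) (P : Prog ρ) (σ : Store ρ) (A : Set (Store ρ)) : ℝ≥0∞ :=
  ⨆ t : ℕ, (runSteps Q (P.start σ) t).toOuterMeasure {c | c.stack = [] ∧ c.store ∈ A}

/-- The expected running time, `∑ₜ Pr[not halted after t steps]`. -/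
def expectedTime (Q : QueryGraph n) (P : Prog ρ) (σ : Store ρ) : ℝ≥0∞ :=
  ∑' t : ℕ, (runSteps Q (P.start σ) t).toOuterMeasure {c | c.stack ≠ []}

/-- The expected number of queries. -/
def expectedQueries (Q : QueryGraph n) (P : Prog ρ) (σ : Store ρ) : ℝ≥0∞ :=
  ⨆ t : ℕ, ∑' c : Config ρ, runSteps Q (P.start σ) t c * (c.queries : ℝ≥0∞)

end Semantics

/-! ### Procedures for sampling an edge almost uniformly

Such a procedure is a program over registers `0, 1, 2, …`. It is called with the parameters
`n`, `η`, `δ` in the registers `0`, `1`, `2` and arbitrary values in the others. It returns the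
labels of the endpoints of an edge in the registers `3` and `4`; the value `0` in register `3` says
that no edge is returned. -/

/-- The parameters `n`, `η`, `δ` are loaded. -/
def SamplerInput (n : ℕ) (η δ : ℝ) (σ : Store ℕ) : Prop :=
  σ 0 = n ∧ σ 1 = η ∧ σ 2 = δ

/-- The stores in which edge `e` is returned (in either orientation). -/
def returnsEdge {n : ℕ} (e : Sym2 (Fin n)) : Set (Store ℕ) :=
  {σ | ∃ u v : Fin n, e = s(u, v) ∧ σ 3 = vertexLabel u ∧ σ 4 = vertexLabel v}

/-- Some edge of the graph is returned. -/
def returnsSomeEdge {n : ℕ} (Q : QueryGraph n) : Set (Store ℕ) :=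
  {σ | ∃ e ∈ Q.graph.edgeSet, σ ∈ returnsEdge e}

/-- No edge is returned. -/
def returnsNoEdge : Set (Store ℕ) := {σ | σ 3 = 0}

/-- On every graph with at least one edge, `S` called with accuracy `η` and any `δ ∈ (0,1)` returns
an edge or reports that none is returned, returns an edge with probability at least `1 - δ`, and
returns each edge with probability in `[(1-η)/m, (1+η)/m]`. -/
def SamplesAlmostUniformly (S : Prog ℕ) (η : ℝ) : Prop :=
  ∀ (n : ℕ) (Q : QueryGraph n) (δ : ℝ) (σ : Store ℕ),
    0 < Q.numEdges → 0 < δ → δ < 1 → SamplerInput n η δ σ →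
      haltProb Q S σ (returnsSomeEdge Q ∪ returnsNoEdge) = 1 ∧
      ENNReal.ofReal (1 - δ) ≤ haltProb Q S σ (returnsSomeEdge Q) ∧
      ∀ e ∈ Q.graph.edgeSet,
        ENNReal.ofReal ((1 - η) / Q.numEdges) ≤ haltProb Q S σ (returnsEdge e) ∧
        haltProb Q S σ (returnsEdge e) ≤ ENNReal.ofReal ((1 + η) / Q.numEdges)

/-- With accuracy `η`, the expected query complexity and running time of `S` are
`Õ(n / √(η m)) · polylog(1/δ)`, where `Õ` hides factors polylogarithmic in `n`. -/
def SamplerComplexity (S : Prog ℕ) (η : ℝ) : Prop :=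
  ∃ (C : ℝ) (k : ℕ), ∀ (n : ℕ) (Q : QueryGraph n) (δ : ℝ) (σ : Store ℕ),
    0 < Q.numEdges → 0 < δ → δ < 1 → SamplerInput n η δ σ →
      let bound := ENNReal.ofReal (C * (n / √(η * Q.numEdges)) * (1 + Real.log n) ^ k *
        (1 + Real.log (1 / δ)) ^ k)
      expectedQueries Q S σ ≤ bound ∧ expectedTime Q S σ ≤ bound

/-! ### The procedure Estimate-high-edges -/

/-- The registers of the procedure itself. -/
inductive Var where
  | n | α | ε | δ
  | zero | one | two | tmp | len | r | δ' | thr | i | count | failed | degU | degV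
  | out
  deriving DecidableEq

/-- The registers of the sampling procedure and those of Estimate-high-edges. -/
abbrev EheReg := ℕ ⊕ Var

/-- A register of Estimate-high-edges. -/
abbrev reg (x : Var) : EheReg := Sum.inr x

/-- A register of the sampling procedure. -/
abbrev sreg (j : ℕ) : EheReg := Sum.inl j

/-- Estimate-high-edges `(n, α, ε, δ)` with `S` as the procedure that samples edges. The answer in
register `out` is `1` for MANY and `0` for FEW. -/
def estimateHighEdges (S : Prog ℕ) : Prog EheReg :=
  .block [
    .op (.const (reg .zero) 0),
    .op (.const (reg .one) 1),
    .op (.const (reg .two) 2),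
    -- `len := ⌈log₂ (2/δ)⌉`
    .op (.const (reg .len) 0),
    .op (.copy (reg .tmp) (reg .δ)),
    .loop (reg .tmp) (reg .two) (.block [
      .op (.mul (reg .tmp) (reg .tmp) (reg .two)),
      .op (.add (reg .len) (reg .len) (reg .one))]),
    -- `r := ⌈100 * len / ε⌉`
    .op (.const (reg .tmp) 100),
    .op (.mul (reg .len) (reg .len) (reg .tmp)),
    .op (.const (reg .r) 0),
    .op (.const (reg .tmp) 0),
    .loop (reg .tmp) (reg .len) (.block [
      .op (.add (reg .r) (reg .r) (reg .one)),
      .op (.mul (reg .tmp) (reg .r) (reg .ε))]),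
    -- `δ' := δ / (2 * r)`
    .op (.mul (reg .tmp) (reg .two) (reg .r)),
    .op (.div (reg .δ') (reg .δ) (reg .tmp)),
    -- `thr := 2 * α / ε`
    .op (.mul (reg .tmp) (reg .two) (reg .α)),
    .op (.div (reg .thr) (reg .tmp) (reg .ε)),
    -- for `i` from `1` to `r`
    .op (.const (reg .count) 0),
    .op (.const (reg .failed) 0),
    .op (.const (reg .i) 0),
    .loop (reg .i) (reg .r) (.block [
      .op (.add (reg .i) (reg .i) (reg .one)),
      -- invoke `S (n, 0.1, δ')`
      .op (.copy (sreg 0) (reg .n)),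
      .op (.const (sreg 1) (1 / 10)),
      .op (.copy (sreg 2) (reg .δ')),
      S.map Sum.inl,
      .ite (sreg 3) (reg .one)
        -- no edge was returned: leave the loop, the answer will be FEW
        (.block [
          .op (.const (reg .failed) 1),
          .op (.copy (reg .i) (reg .r))])
        -- count the edge if both of its endpoints are high-degree vertices
        (.block [
          .op (.degree (reg .degU) (sreg 3)),
          .op (.degree (reg .degV) (sreg 4)),
          .ite (reg .thr) (reg .degU)
            (.ite (reg .thr) (reg .degV)
              (.op (.add (reg .count) (reg .count) (reg .one)))
              .skip)
            .skip])]),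
    .ite (reg .zero) (reg .failed)
      (.op (.const (reg .out) 0))
      -- MANY if `count / r > 2.6 * ε`, otherwise FEW
      (.block [
        .op (.div (reg .count) (reg .count) (reg .r)),
        .op (.const (reg .tmp) (26 / 10)),
        .op (.mul (reg .tmp) (reg .tmp) (reg .ε)),
        .ite (reg .tmp) (reg .count)
          (.op (.const (reg .out) 1))
          (.op (.const (reg .out) 0))])]

/-- The parameters `n`, `α`, `ε`, `δ` are loaded; the other registers may hold anything. -/
def EheInput (n : ℕ) (α ε δ : ℝ) (σ : Store EheReg) : Prop :=
  σ (reg .n) = n ∧ σ (reg .α) = α ∧ σ (reg .ε) = ε ∧ σ (reg .δ) = δ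

/-- The answer is MANY. -/
def answersMany : Set (Store EheReg) := {σ | σ (reg .out) = 1}

/-- The answer is FEW. -/
def answersFew : Set (Store EheReg) := {σ | σ (reg .out) = 0}

end

noncomputable section

/-! ### Expectations -/

/-! Everything is reduced to one quantity, `runCost`: the expected cost `τ` per step plus the
expected value of `f` at the final store. With `τ = 0` and `f` an indicator it is a halting
probability; with `τ = 1` and `f = 0` it is the expected time, which also dominates the expected
number of queries. It unfolds instruction by instruction and composes along sequences of programs
(`runCost_append`), so each claim about a loop becomes an induction on the remaining turns.

Part (a) is a Chernoff bound in potential form. `ehe_loop_le_one_add` says that a function `Φ j c`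
of the remaining samples `j` and the current count `c` bounds the probability of a wrong answer or
of not halting, as soon as it does not increase on average over one call of the sampler and is at
least 1 when the final answer is wrong. A sample is high with probability at least `0.9 * 4ε` in the
first case and at most `1.1 * 2ε` in the second, so the threshold `2.6ε` lies strictly between, and
exponential potentials give `δ / 2`. Returning no edge costs at most `r * δ' = δ / 2` in the first
case and nothing in the second, where FEW is right.

Part (b) needs a sampler that does not know `m`. For a threshold `θ` with `θ² ≥ 40m`, there are at
most `2m / θ ≤ θ / 20` heavy vertices, so at least 19/20 of the neighbors of a heavy vertex are
light (`le_lightDeg`). Hence a trial returns every oriented edge with the same probability `1 /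
(2n⌊θ⌋)` up to a factor in `[19/20, 1]`, whether it leaves a light vertex directly or a heavy vertex
reached from a light neighbor. Trial number `k` uses the threshold `A / k`, with `A = 160nL`: the
first `A / √(40m)` trials are the good ones, and their success probabilities grow linearly in `k`,
so all of them fail with probability at most `δ / (20n²)` (`prod_failProb_le`). This bounds the bias
caused by the later trials, the probability of returning nothing, and the time spent after the good
trials. The time is therefore of order `A / √m`, that is, `n / √m` up to logarithms, and
Estimate-high-edges multiplies it by `r`, which is of order `log(2/δ) / ε`. -/

/-- The expectation of `f` under `p`. -/
def PMF.ev {α : Type*} (p : PMF α) (f : α → ℝ≥0∞) : ℝ≥0∞ := ∑' a, p a * f a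

namespace PMF

variable {α β : Type*}

theorem ev_pure (a : α) (f : α → ℝ≥0∞) : (PMF.pure a).ev f = f a := by
  classical
  unfold ev
  rw [tsum_eq_single a]
  · simp
  · intro b hb
    simp [PMF.pure_apply, hb]

theorem ev_bind (p : PMF α) (g : α → PMF β) (f : β → ℝ≥0∞) :
    (p.bind g).ev f = p.ev fun a => (g a).ev f := by
  unfold ev
  simp only [PMF.bind_apply, ← ENNReal.tsum_mul_right, ← ENNReal.tsum_mul_left]
  rw [ENNReal.tsum_comm]
  simp only [mul_assoc]

theorem ev_map (p : PMF α) (g : α → β) (f : β → ℝ≥0∞) :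
    (p.map g).ev f = p.ev fun a => f (g a) := by
  rw [← PMF.bind_pure_comp, ev_bind]
  simp [ev_pure]

theorem ev_mono (p : PMF α) {f g : α → ℝ≥0∞} (h : ∀ a, f a ≤ g a) : p.ev f ≤ p.ev g :=
  ENNReal.tsum_le_tsum fun a => by gcongr; exact h a

theorem ev_add (p : PMF α) (f g : α → ℝ≥0∞) :
    (p.ev fun a => f a + g a) = p.ev f + p.ev g := by
  simp only [ev, mul_add, ENNReal.tsum_add]

theorem ev_const (p : PMF α) (c : ℝ≥0∞) : (p.ev fun _ => c) = c := by
  simp only [ev, ENNReal.tsum_mul_right, PMF.tsum_coe, one_mul]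

theorem ev_const_mul (p : PMF α) (c : ℝ≥0∞) (f : α → ℝ≥0∞) :
    (p.ev fun a => c * f a) = c * p.ev f := by
  simp only [ev, ← ENNReal.tsum_mul_left]
  exact tsum_congr fun a => by ring

theorem ev_sum {ι : Type*} (p : PMF α) (s : Finset ι) (f : ι → α → ℝ≥0∞) :
    (p.ev fun a => ∑ i ∈ s, f i a) = ∑ i ∈ s, p.ev (f i) := by
  classical
  induction s using Finset.induction_on with
  | empty => simpa using p.ev_const 0
  | insert i s hi ih => simp only [Finset.sum_insert hi, ev_add, ih]

/-- Monotone convergence for the counting measure, with the top σ-algebra making every function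
measurable. -/
theorem ev_iSup (p : PMF α) {f : ℕ → α → ℝ≥0∞} (h : Monotone f) :
    (p.ev fun a => ⨆ t, f t a) = ⨆ t, p.ev (f t) := by
  let _ : MeasurableSpace α := ⊤
  simp only [ev, ENNReal.mul_iSup, ← MeasureTheory.lintegral_count]
  refine MeasureTheory.lintegral_iSup (fun _ => measurable_from_top) fun s t hst a => ?_
  exact mul_le_mul_right (h hst a) _

theorem toOuterMeasure_eq_ev (p : PMF α) (s : Set α) :
    p.toOuterMeasure s = p.ev (s.indicator 1) := by
  classical
  rw [PMF.toOuterMeasure_apply]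
  refine tsum_congr fun a => ?_
  by_cases h : a ∈ s <;> simp [h]

end PMF

theorem ev_uniformUpTo {N : ℕ} (hN : 0 < N) (f : ℝ → ℝ≥0∞) :
    (uniformUpTo N).ev f = (N : ℝ≥0∞)⁻¹ * ∑ j : Fin N, f ((j : ℝ) + 1) := by
  obtain ⟨j, rfl⟩ : ∃ j, N = j + 1 := ⟨N - 1, by omega⟩
  have h : uniformUpTo (j + 1) =
      (PMF.uniformOfFintype (Fin (j + 1))).map fun i : Fin (j + 1) => ((i : ℕ) : ℝ) + 1 := by
    simp only [uniformUpTo, bind_pure_comp, PMF.monad_map_eq_map, PMF.map_comp]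
    rfl
  rw [h, PMF.ev_map, PMF.ev, tsum_fintype]
  simp [Finset.mul_sum]

/-! ### Expected cost of running a program -/

theorem Instr.queries_le_one {ρ : Type} (i : Instr ρ) : i.queries ≤ 1 := by
  cases i <;> simp [Instr.queries]

section Cost

variable {n : ℕ} {ρ : Type} [DecidableEq ρ]

open Classical in
/-- The expected value of `τ` per step plus `f` of the final store, counting the first `t` steps
only. -/
def costUpTo (Q : QueryGraph n) (τ : ℝ≥0∞) (f : Store ρ → ℝ≥0∞) : ℕ → Config ρ → ℝ≥0∞
  | 0, c => if c.stack = [] then f c.store else 0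
  | t + 1, c => if c.stack = [] then f c.store else τ + (step Q c).ev (costUpTo Q τ f t)

/-- The expected value of `τ` per step plus `f` of the final store, where runs that do not halt
contribute nothing to the latter. -/
def runCost (Q : QueryGraph n) (τ : ℝ≥0∞) (f : Store ρ → ℝ≥0∞) (K : List (Prog ρ))
    (σ : Store ρ) : ℝ≥0∞ :=
  ⨆ t, costUpTo Q τ f t ⟨K, σ, 0⟩

variable (Q : QueryGraph n) (τ : ℝ≥0∞) (f : Store ρ → ℝ≥0∞)

theorem costUpTo_halted (t : ℕ) (σ : Store ρ) (q : ℕ) : costUpTo Q τ f t ⟨[], σ, q⟩ = f σ := by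
  cases t <;> simp [costUpTo]

theorem costUpTo_succ (t : ℕ) {c : Config ρ} (h : c.stack ≠ []) :
    costUpTo Q τ f (t + 1) c = τ + (step Q c).ev (costUpTo Q τ f t) := by
  simp [costUpTo, h]

theorem costUpTo_le_succ (t : ℕ) (c : Config ρ) :
    costUpTo Q τ f t c ≤ costUpTo Q τ f (t + 1) c := by
  induction t generalizing c with
  | zero =>
    by_cases h : c.stack = [] <;> simp [costUpTo, h]
  | succ t ih =>
    by_cases h : c.stack = []
    · simp [costUpTo, h]
    · rw [costUpTo_succ _ _ _ _ h, costUpTo_succ _ _ _ _ h]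
      gcongr
      exact PMF.ev_mono _ ih

theorem costUpTo_mono : Monotone (costUpTo Q τ f) :=
  monotone_nat_of_le_succ fun t c => costUpTo_le_succ Q τ f t c

/-- The query counter never influences the execution, which is why `runCost` may start it at 0. -/
theorem costUpTo_queries (t : ℕ) (K : List (Prog ρ)) (σ : Store ρ) (q q' : ℕ) :
    costUpTo Q τ f t ⟨K, σ, q⟩ = costUpTo Q τ f t ⟨K, σ, q'⟩ := by
  induction t generalizing K σ q q' with
  | zero => simp [costUpTo]
  | succ t ih =>
    rcases K with _ | ⟨P, K⟩
    · simp [costUpTo]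
    rw [costUpTo_succ _ _ _ _ (by simp), costUpTo_succ _ _ _ _ (by simp)]
    congr 1
    cases P <;> simp only [step, PMF.ev_pure, PMF.ev_map]
    case op i => congr 1; funext σ'; exact ih ..
    all_goals exact ih ..

theorem iSup_costUpTo (c : Config ρ) :
    ⨆ t, costUpTo Q τ f t c = runCost Q τ f c.stack c.store := by
  refine iSup_congr fun t => ?_
  exact costUpTo_queries Q τ f t _ _ _ _

theorem runCost_cons (P : Prog ρ) (K : List (Prog ρ)) (σ : Store ρ) :
    runCost Q τ f (P :: K) σ =
      τ + (step Q ⟨P :: K, σ, 0⟩).ev fun c => runCost Q τ f c.stack c.store := by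
  simp only [← iSup_costUpTo]
  rw [PMF.ev_iSup _ (costUpTo_mono Q τ f), ENNReal.add_iSup, runCost,
    ← (show Monotone fun t => costUpTo Q τ f t ⟨P :: K, σ, 0⟩ from
      fun s t h => costUpTo_mono Q τ f h _).iSup_nat_add 1]
  exact iSup_congr fun t => costUpTo_succ _ _ _ _ (by simp)

theorem runCost_nil (σ : Store ρ) : runCost Q τ f [] σ = f σ := by
  simp [runCost, costUpTo_halted]

theorem runCost_skip (K : List (Prog ρ)) (σ : Store ρ) :
    runCost Q τ f (.skip :: K) σ = τ + runCost Q τ f K σ := by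
  rw [runCost_cons]; simp [step, PMF.ev_pure]

theorem runCost_op (i : Instr ρ) (K : List (Prog ρ)) (σ : Store ρ) :
    runCost Q τ f (.op i :: K) σ = τ + (i.eval Q σ).ev (runCost Q τ f K) := by
  rw [runCost_cons]; simp [step, PMF.ev_map]

theorem runCost_seq (a b : Prog ρ) (K : List (Prog ρ)) (σ : Store ρ) :
    runCost Q τ f (.seq a b :: K) σ = τ + runCost Q τ f (a :: b :: K) σ := by
  rw [runCost_cons]; simp [step, PMF.ev_pure]

open Classical in
theorem runCost_ite (x y : ρ) (a b : Prog ρ) (K : List (Prog ρ)) (σ : Store ρ) :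
    runCost Q τ f (.ite x y a b :: K) σ =
      τ + runCost Q τ f ((if σ x < σ y then a else b) :: K) σ := by
  rw [runCost_cons]; simp [step, PMF.ev_pure]

open Classical in
theorem runCost_loop (x y : ρ) (a : Prog ρ) (K : List (Prog ρ)) (σ : Store ρ) :
    runCost Q τ f (.loop x y a :: K) σ =
      τ + runCost Q τ f (if σ x < σ y then a :: .loop x y a :: K else K) σ := by
  rw [runCost_cons]; simp [step, PMF.ev_pure]

/-- A step budget for the whole list does not split into fixed budgets for the two parts, so each
truncated cost is compared with an untruncated one. This inequality and the next together give
`runCost_append`. -/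
theorem costUpTo_append_le (K' : List (Prog ρ)) (t : ℕ) (K : List (Prog ρ)) (σ : Store ρ) (q : ℕ) :
    costUpTo Q τ f t ⟨K ++ K', σ, q⟩ ≤ runCost Q τ (runCost Q τ f K') K σ := by
  induction t generalizing K σ q with
  | zero =>
    rcases K with _ | ⟨P, K⟩
    · rw [runCost_nil, List.nil_append, costUpTo_queries Q τ f 0 K' σ q 0]
      exact le_iSup (fun t => costUpTo Q τ f t ⟨K', σ, 0⟩) 0
    · simp [costUpTo]
  | succ t ih =>
    rcases K with _ | ⟨P, K⟩
    · rw [runCost_nil, List.nil_append, costUpTo_queries Q τ f _ K' σ q 0]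
      exact le_iSup (fun t => costUpTo Q τ f t ⟨K', σ, 0⟩) (t + 1)
    rw [costUpTo_succ _ _ _ _ (by simp), runCost_cons]
    gcongr
    cases P <;> simp only [List.cons_append, step, PMF.ev_pure, PMF.ev_map]
    case op i => exact PMF.ev_mono _ fun σ' => ih ..
    case loop x y a =>
      split_ifs
      · exact ih (a :: .loop x y a :: K) σ q
      · exact ih ..
    case seq a b => exact ih (a :: b :: K) σ q
    case skip => exact ih ..
    case ite x y a b => exact ih (_ :: K) σ q

theorem costUpTo_le_append (K' : List (Prog ρ)) (t : ℕ) (K : List (Prog ρ)) (σ : Store ρ) (q : ℕ) :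
    costUpTo Q τ (runCost Q τ f K') t ⟨K, σ, q⟩ ≤ runCost Q τ f (K ++ K') σ := by
  induction t generalizing K σ q with
  | zero =>
    rcases K with _ | ⟨P, K⟩ <;> simp [costUpTo]
  | succ t ih =>
    rcases K with _ | ⟨P, K⟩
    · simp [costUpTo]
    rw [costUpTo_succ _ _ _ _ (by simp), List.cons_append, runCost_cons]
    gcongr
    cases P <;> simp only [step, PMF.ev_pure, PMF.ev_map]
    case op i => exact PMF.ev_mono _ fun σ' => ih ..
    case loop x y a =>
      split_ifs
      · exact ih (a :: .loop x y a :: K) σ q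
      · exact ih ..
    case seq a b => exact ih (a :: b :: K) σ q
    case skip => exact ih ..
    case ite x y a b => exact ih (_ :: K) σ q

/-- Running one list of programs after another. -/
theorem runCost_append (K K' : List (Prog ρ)) (σ : Store ρ) :
    runCost Q τ f (K ++ K') σ = runCost Q τ (runCost Q τ f K') K σ :=
  le_antisymm (iSup_le fun t => costUpTo_append_le Q τ f K' t K σ 0)
    (iSup_le fun t => costUpTo_le_append Q τ f K' t K σ 0)

theorem runCost_cons_eq (P : Prog ρ) (K : List (Prog ρ)) (σ : Store ρ) :
    runCost Q τ f (P :: K) σ = runCost Q τ (runCost Q τ f K) [P] σ :=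
  runCost_append Q τ f [P] K σ

/-! ### Monotonicity and linearity of costs -/

variable {f} in
theorem runCost_mono {g : Store ρ → ℝ≥0∞} (h : ∀ σ, f σ ≤ g σ) (K : List (Prog ρ)) (σ : Store ρ) :
    runCost Q τ f K σ ≤ runCost Q τ g K σ := by
  refine iSup_mono fun t => ?_
  generalize (⟨K, σ, 0⟩ : Config ρ) = c
  induction t generalizing c with
  | zero => simp only [costUpTo]; split_ifs <;> simp [h]
  | succ t ih =>
    simp only [costUpTo]
    split_ifs
    · exact h _
    · gcongr; exact PMF.ev_mono _ ih

theorem costUpTo_add (τ' : ℝ≥0∞) (g : Store ρ → ℝ≥0∞) (t : ℕ) (c : Config ρ) :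
    costUpTo Q (τ + τ') (fun σ => f σ + g σ) t c = costUpTo Q τ f t c + costUpTo Q τ' g t c := by
  induction t generalizing c with
  | zero => simp only [costUpTo]; split_ifs <;> simp
  | succ t ih =>
    simp only [costUpTo]
    split_ifs
    · rfl
    · rw [show costUpTo Q (τ + τ') (fun σ => f σ + g σ) t = _ from funext ih, PMF.ev_add]
      ring

/-- Costs are additive. -/
theorem runCost_add (τ' : ℝ≥0∞) (g : Store ρ → ℝ≥0∞) (K : List (Prog ρ)) (σ : Store ρ) :
    runCost Q (τ + τ') (fun σ => f σ + g σ) K σ = runCost Q τ f K σ + runCost Q τ' g K σ := by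
  simp only [runCost, costUpTo_add]
  exact (ENNReal.iSup_add_iSup_of_monotone (fun s t h => costUpTo_mono Q τ f h _)
    (fun s t h => costUpTo_mono Q τ' g h _)).symm

theorem runCost_zero_add (g : Store ρ → ℝ≥0∞) (K : List (Prog ρ)) (σ : Store ρ) :
    runCost Q 0 (fun σ => f σ + g σ) K σ = runCost Q 0 f K σ + runCost Q 0 g K σ := by
  simpa using runCost_add Q 0 f 0 g K σ

/-- Separates the cost of the steps of `K` from the expected value of whatever follows; time bounds
use it with `f` the cost of the remaining programs. -/
theorem runCost_eq_time_add (K : List (Prog ρ)) (σ : Store ρ) :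
    runCost Q τ f K σ = runCost Q τ (fun _ => 0) K σ + runCost Q 0 f K σ := by
  simpa using runCost_add Q τ (fun _ => 0) 0 f K σ

theorem runCost_zero_const_mul (a : ℝ≥0∞) (K : List (Prog ρ)) (σ : Store ρ) :
    runCost Q 0 (fun σ => a * f σ) K σ = a * runCost Q 0 f K σ := by
  simp only [runCost, ENNReal.mul_iSup]
  refine iSup_congr fun t => ?_
  generalize (⟨K, σ, 0⟩ : Config ρ) = c
  induction t generalizing c with
  | zero => simp only [costUpTo]; split_ifs <;> simp
  | succ t ih =>
    simp only [costUpTo]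
    split_ifs
    · rfl
    · rw [show costUpTo Q 0 (fun σ => a * f σ) t = _ from funext ih, PMF.ev_const_mul]
      ring

theorem runCost_zero_sum {ι : Type*} (s : Finset ι) (g : ι → Store ρ → ℝ≥0∞)
    (K : List (Prog ρ)) (σ : Store ρ) :
    runCost Q 0 (fun σ => ∑ i ∈ s, g i σ) K σ = ∑ i ∈ s, runCost Q 0 (g i) K σ := by
  classical
  induction s using Finset.induction_on with
  | empty =>
    simpa using runCost_zero_const_mul Q (fun _ => 0) 0 K σ
  | insert i s hi ih => simp only [Finset.sum_insert hi, runCost_zero_add, ih]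

/-- Only an inequality, because runs that do not halt contribute nothing. -/
theorem runCost_zero_const_le (a : ℝ≥0∞) (K : List (Prog ρ)) (σ : Store ρ) :
    runCost Q 0 (fun _ => a) K σ ≤ a := by
  refine iSup_le fun t => ?_
  generalize (⟨K, σ, 0⟩ : Config ρ) = c
  induction t generalizing c with
  | zero => simp only [costUpTo]; split_ifs <;> simp
  | succ t ih =>
    simp only [costUpTo]
    split_ifs
    · rfl
    · rw [zero_add]; exact (PMF.ev_mono _ ih).trans (PMF.ev_const _ _).le

variable {f} in
theorem runCost_zero_le {a : ℝ≥0∞} (h : ∀ σ, f σ ≤ a) (K : List (Prog ρ)) (σ : Store ρ) :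
    runCost Q 0 f K σ ≤ a :=
  (runCost_mono Q 0 h K σ).trans (runCost_zero_const_le Q a K σ)

/-! ### Relation to the probability of halting and to the expected time -/

/-- `runSteps` adds steps at the end whereas `costUpTo` peels them off at the start; by
associativity of `bind` the two agree. -/
theorem runSteps_succ_eq (c : Config ρ) (t : ℕ) :
    runSteps Q c (t + 1) = (step Q c).bind fun c' => runSteps Q c' t := by
  induction t with
  | zero => simp [runSteps]
  | succ t ih =>
    rw [runSteps, ih, PMF.bind_bind]
    rfl

theorem runSteps_halted (σ : Store ρ) (q t : ℕ) :
    runSteps Q ⟨[], σ, q⟩ t = PMF.pure ⟨[], σ, q⟩ := by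
  induction t with
  | zero => rfl
  | succ t ih => simp [runSteps, ih, step]

theorem haltProb_eq_runCost (P : Prog ρ) (σ : Store ρ) (A : Set (Store ρ)) :
    haltProb Q P σ A = runCost Q 0 (A.indicator 1) [P] σ := by
  classical
  refine iSup_congr fun t => ?_
  rw [Prog.start]
  generalize (⟨[P], σ, 0⟩ : Config ρ) = c
  rw [PMF.toOuterMeasure_eq_ev]
  induction t generalizing c with
  | zero =>
    rw [runSteps, PMF.ev_pure]
    by_cases h : c.stack = [] <;> simp [costUpTo, h, Set.indicator]
  | succ t ih =>
    rcases c with ⟨_ | ⟨P, K⟩, σ, q⟩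
    · rw [runSteps_halted, PMF.ev_pure]
      simp [costUpTo, Set.indicator]
    · rw [runSteps_succ_eq, PMF.ev_bind, costUpTo_succ _ _ _ _ (by simp), zero_add]
      congr 1
      funext c
      exact ih c

/-- The tail-sum formula for the expected running time, truncated at `t`: step number `s + 1` is
paid for exactly if the run has not halted after `s` steps. -/
theorem costUpTo_one_zero (t : ℕ) (c : Config ρ) :
    costUpTo Q 1 (fun _ => 0) t c =
      ∑ s ∈ Finset.range t, (runSteps Q c s).toOuterMeasure {c | c.stack ≠ []} := by
  induction t generalizing c with
  | zero => simp [costUpTo]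
  | succ t ih =>
    simp only [PMF.toOuterMeasure_eq_ev] at ih ⊢
    rcases c with ⟨_ | ⟨P, K⟩, σ, q⟩
    · simp [costUpTo, runSteps_halted, PMF.ev_pure]
    · rw [costUpTo_succ _ _ _ _ (by simp), Finset.sum_range_succ', add_comm]
      congr 1
      · simp only [runSteps_succ_eq, PMF.ev_bind]
        rw [← PMF.ev_sum]
        congr 1
        funext c
        exact ih c
      · simp [runSteps, PMF.ev_pure]

theorem expectedTime_eq_runCost (P : Prog ρ) (σ : Store ρ) :
    expectedTime Q P σ = runCost Q 1 (fun _ => 0) [P] σ := by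
  rw [expectedTime, ENNReal.tsum_eq_iSup_nat]
  exact iSup_congr fun t => (costUpTo_one_zero Q t _).symm

/-- A step makes at most one query and a halted configuration makes none. Summed over time, this
lets every bound on the time serve as a bound on the queries. -/
theorem ev_step_queries_le (c : Config ρ) :
    (step Q c).ev (fun c => (c.queries : ℝ≥0∞)) ≤
      c.queries + ({c | c.stack ≠ []} : Set (Config ρ)).indicator 1 c := by
  rcases c with ⟨_ | ⟨P, K⟩, σ, q⟩
  · simp [step, PMF.ev_pure]
  · cases P <;> simp only [step, PMF.ev_pure, PMF.ev_map, PMF.ev_const]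
    case op i => simpa using Instr.queries_le_one i
    all_goals simp

theorem expectedQueries_le_expectedTime (P : Prog ρ) (σ : Store ρ) :
    expectedQueries Q P σ ≤ expectedTime Q P σ := by
  rw [expectedTime, ENNReal.tsum_eq_iSup_nat]
  refine iSup_mono fun t => ?_
  change (runSteps Q (P.start σ) t).ev (fun c => (c.queries : ℝ≥0∞)) ≤ _
  induction t with
  | zero => simp [runSteps, PMF.ev_pure, Prog.start]
  | succ t ih =>
    rw [runSteps, PMF.ev_bind, Finset.sum_range_succ, PMF.toOuterMeasure_eq_ev]
    refine (PMF.ev_mono _ (ev_step_queries_le Q)).trans ?_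
    rw [PMF.ev_add]
    gcongr

end Cost

/-! ### Single instructions -/

section Instructions

variable {n : ℕ} {ρ : Type} [DecidableEq ρ]
variable (Q : QueryGraph n) (τ : ℝ≥0∞) (f : Store ρ → ℝ≥0∞) (K : List (Prog ρ)) (σ : Store ρ)

theorem runCost_const (x : ρ) (c : ℚ) : runCost Q τ f (.op (.const x c) :: K) σ =
    τ + runCost Q τ f K (Function.update σ x c) := by
  rw [runCost_op, Instr.eval, PMF.ev_pure]

theorem runCost_copy (x y : ρ) : runCost Q τ f (.op (.copy x y) :: K) σ =
    τ + runCost Q τ f K (Function.update σ x (σ y)) := by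
  rw [runCost_op, Instr.eval, PMF.ev_pure]

theorem runCost_addInstr (x y z : ρ) : runCost Q τ f (.op (.add x y z) :: K) σ =
    τ + runCost Q τ f K (Function.update σ x (σ y + σ z)) := by
  rw [runCost_op, Instr.eval, PMF.ev_pure]

theorem runCost_mul (x y z : ρ) : runCost Q τ f (.op (.mul x y z) :: K) σ =
    τ + runCost Q τ f K (Function.update σ x (σ y * σ z)) := by
  rw [runCost_op, Instr.eval, PMF.ev_pure]

theorem runCost_div (x y z : ρ) : runCost Q τ f (.op (.div x y z) :: K) σ =
    τ + runCost Q τ f K (Function.update σ x (σ y / σ z)) := by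
  rw [runCost_op, Instr.eval, PMF.ev_pure]

theorem runCost_degree (x y : ρ) : runCost Q τ f (.op (.degree x y) :: K) σ =
    τ + runCost Q τ f K (Function.update σ x (Q.degAnswer (σ y))) := by
  rw [runCost_op, Instr.eval, PMF.ev_pure]

theorem runCost_neighbor (x y z : ρ) : runCost Q τ f (.op (.neighbor x y z) :: K) σ =
    τ + runCost Q τ f K (Function.update σ x (Q.nbrAnswer (σ y) (σ z))) := by
  rw [runCost_op, Instr.eval, PMF.ev_pure]

theorem runCost_rand (x y : ρ) {N : ℕ} (hN : 0 < N) (hy : ⌊σ y⌋₊ = N) :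
    runCost Q τ f (.op (.rand x y) :: K) σ = τ + (N : ℝ≥0∞)⁻¹ *
      ∑ j : Fin N, runCost Q τ f K (Function.update σ x ((j : ℝ) + 1)) := by
  rw [runCost_op, Instr.eval, PMF.ev_map, hy, ev_uniformUpTo hN]

theorem runCost_block_nil : runCost Q τ f (.block [] :: K) σ = τ + runCost Q τ f K σ :=
  runCost_skip ..

theorem runCost_block_cons (P : Prog ρ) (L : List (Prog ρ)) :
    runCost Q τ f (.block (P :: L) :: K) σ = τ + runCost Q τ f (P :: .block L :: K) σ :=
  runCost_seq ..

theorem runCost_ite_pos {x y : ρ} {a b : Prog ρ} (h : σ x < σ y) :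
    runCost Q τ f (.ite x y a b :: K) σ = τ + runCost Q τ f (a :: K) σ := by
  rw [runCost_ite, if_pos h]

theorem runCost_ite_neg {x y : ρ} {a b : Prog ρ} (h : ¬σ x < σ y) :
    runCost Q τ f (.ite x y a b :: K) σ = τ + runCost Q τ f (b :: K) σ := by
  rw [runCost_ite, if_neg h]

theorem runCost_loop_pos {x y : ρ} {a : Prog ρ} (h : σ x < σ y) :
    runCost Q τ f (.loop x y a :: K) σ = τ + runCost Q τ f (a :: .loop x y a :: K) σ := by
  rw [runCost_loop, if_pos h]

theorem runCost_loop_neg {x y : ρ} {a : Prog ρ} (h : ¬σ x < σ y) :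
    runCost Q τ f (.loop x y a :: K) σ = τ + runCost Q τ f K σ := by
  rw [runCost_loop, if_neg h]

end Instructions

/-! ### Programs without loops -/

/-- A program without loops. -/
def Prog.LoopFree {ρ : Type} : Prog ρ → Prop
  | .skip => True
  | .op _ => True
  | .seq a b => a.LoopFree ∧ b.LoopFree
  | .ite _ _ a b => a.LoopFree ∧ b.LoopFree
  | .loop _ _ _ => False

/-- The number of nodes of a program. -/
def Prog.size {ρ : Type} : Prog ρ → ℕ
  | .skip => 1
  | .op _ => 1
  | .seq a b => 1 + (a.size + b.size)
  | .ite _ _ a b => 1 + (a.size + b.size)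
  | .loop _ _ a => 1 + a.size

/-- Without loops each node of the program is executed at most once, at the price of one step. -/
theorem Prog.LoopFree.time_le {n : ℕ} {ρ : Type} [DecidableEq ρ] (Q : QueryGraph n) {P : Prog ρ}
    (hP : P.LoopFree) (σ : Store ρ) : runCost Q 1 (fun _ => 0) [P] σ ≤ P.size := by
  induction P generalizing σ with
  | skip => simp [runCost_skip, runCost_nil, Prog.size]
  | op i =>
    rw [runCost_op, show runCost Q 1 (fun _ => 0) ([] : List (Prog ρ)) = fun _ => 0 from
      funext fun σ => runCost_nil ..]
    simp [PMF.ev_const, Prog.size]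
  | seq a b iha ihb =>
    rw [runCost_seq, runCost_cons_eq, runCost_eq_time_add, Prog.size]
    push_cast
    gcongr
    · exact iha hP.1 σ
    · exact runCost_zero_le Q (ihb hP.2) _ _
  | ite x y a b iha ihb =>
    rw [runCost_ite, Prog.size]
    push_cast
    gcongr
    split_ifs
    · exact (iha hP.1 σ).trans le_self_add
    · exact (ihb hP.2 σ).trans le_add_self
  | loop => exact hP.elim

/-! ### Renaming of registers -/

section Map

variable {n : ℕ} {ρ ν : Type} [DecidableEq ρ] [DecidableEq ν]

theorem update_elim_inl (s : Store ρ) (v : Store ν) (x : ρ) (c : ℝ) :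
    Function.update (Sum.elim s v) (Sum.inl x) c = Sum.elim (Function.update s x c) v := by
  ext y
  rcases y with y | y
  · by_cases h : y = x <;> simp [h]
  · simp

theorem Instr.eval_map_inl (Q : QueryGraph n) (s : Store ρ) (v : Store ν) (i : Instr ρ) :
    (i.map (Sum.inl : ρ → ρ ⊕ ν)).eval Q (Sum.elim s v) =
      (i.eval Q s).map fun s' => Sum.elim s' v := by
  cases i <;>
    simp only [Instr.map, Instr.eval, PMF.pure_map, PMF.map_comp, Function.comp_def,
      update_elim_inl, Sum.elim_inl]

/-- The renamed program runs in lockstep with the original on the left half of the store, while the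
right half stays frozen at `v`. -/
theorem costUpTo_map_inl (Q : QueryGraph n) (τ : ℝ≥0∞) (f : Store (ρ ⊕ ν) → ℝ≥0∞) (t : ℕ)
    (K : List (Prog ρ)) (s : Store ρ) (v : Store ν) (q : ℕ) :
    costUpTo Q τ f t ⟨K.map (Prog.map Sum.inl), Sum.elim s v, q⟩ =
      costUpTo Q τ (fun s => f (Sum.elim s v)) t ⟨K, s, q⟩ := by
  induction t generalizing K s q with
  | zero => rcases K with _ | ⟨P, K⟩ <;> simp [costUpTo]
  | succ t ih =>
    rcases K with _ | ⟨P, K⟩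
    · simp [costUpTo]
    rw [costUpTo_succ _ _ _ _ (by simp), costUpTo_succ _ _ _ _ (by simp)]
    congr 1
    cases P <;> simp only [List.map_cons, Prog.map, step, PMF.ev_pure, PMF.ev_map,
      Instr.eval_map_inl, Sum.elim_inl]
    case op i =>
      have hq : (i.map (Sum.inl : ρ → ρ ⊕ ν)).queries = i.queries := by
        cases i <;> rfl
      simp only [ih, hq]
    case skip => exact ih ..
    case seq a b => exact ih (a :: b :: K) s q
    case ite x y a b =>
      by_cases h : s x < s y <;> simp only [h, if_true, if_false]
      · exact ih (a :: K) s q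
      · exact ih (b :: K) s q
    case loop x y a =>
      by_cases h : s x < s y <;> simp only [h, if_true, if_false]
      · exact ih (a :: .loop x y a :: K) s q
      · exact ih ..

/-- A program whose registers are renamed by `Sum.inl` leaves the other registers alone. -/
theorem runCost_map_inl (Q : QueryGraph n) (τ : ℝ≥0∞) (f : Store (ρ ⊕ ν) → ℝ≥0∞)
    (P : Prog ρ) (K : List (Prog (ρ ⊕ ν))) (σ : Store (ρ ⊕ ν)) :
    runCost Q τ f (P.map Sum.inl :: K) σ =
      runCost Q τ (fun s => runCost Q τ f K (Sum.elim s (σ ∘ Sum.inr))) [P] (σ ∘ Sum.inl) := by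
  rw [runCost_cons_eq]
  have h := fun t => costUpTo_map_inl Q τ (runCost Q τ f K) t [P] (σ ∘ Sum.inl) (σ ∘ Sum.inr) 0
  simp only [Sum.elim_comp_inl_inr] at h
  exact iSup_congr h

end Map

/-! ### Answers to queries -/

section Queries

variable {n : ℕ}

theorem vertexLabel_injective : Function.Injective (vertexLabel : Fin n → ℝ) := by
  intro u v h
  simp only [vertexLabel, add_left_inj, Nat.cast_inj] at h
  exact Fin.ext h

theorem one_le_vertexLabel (v : Fin n) : 1 ≤ vertexLabel v := by
  simp [vertexLabel]

theorem vertexAt_vertexLabel (v : Fin n) : vertexAt n (vertexLabel v) = some v := by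
  have h : ∃ u : Fin n, vertexLabel u = vertexLabel v := ⟨v, rfl⟩
  rw [vertexAt, dif_pos h, vertexLabel_injective h.choose_spec]

theorem QueryGraph.degAnswer_vertexLabel (Q : QueryGraph n) (v : Fin n) :
    Q.degAnswer (vertexLabel v) = Q.deg v := by
  simp [QueryGraph.degAnswer, vertexAt_vertexLabel]

theorem QueryGraph.nbrAnswer_vertexLabel (Q : QueryGraph n) (v : Fin n) (i : Fin (Q.deg v)) :
    Q.nbrAnswer (vertexLabel v) ((i : ℝ) + 1) = vertexLabel (Q.nbr v i : Fin n) := by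
  have h : ∃ j : Fin (Q.graph.neighborSet v).ncard, (j : ℝ) + 1 = (i : ℝ) + 1 := ⟨i, rfl⟩
  have h' : h.choose = i := by
    exact Fin.ext (Nat.cast_injective (add_right_cancel h.choose_spec))
  simp only [QueryGraph.nbrAnswer, vertexAt_vertexLabel]
  rw [dif_pos h, h']

theorem QueryGraph.nbrAnswer_of_le (Q : QueryGraph n) (v : Fin n) (j : ℕ) (h : Q.deg v ≤ j) :
    Q.nbrAnswer (vertexLabel v) ((j : ℝ) + 1) = 0 := by
  simp only [QueryGraph.nbrAnswer, vertexAt_vertexLabel]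
  rw [dif_neg]
  rintro ⟨i, hi⟩
  simp only [add_left_inj, Nat.cast_inj] at hi
  have := i.2
  simp only [QueryGraph.deg] at h
  omega

end Queries

/-! ### Deterministic loops -/

/-- Quantifying `hbody` over all `τ`, `f` and `K` expresses that the body is deterministic and takes
exactly `c` steps. A turn costs `c + 1` steps including its test, and the last, failing test costs
one more. -/
theorem runCost_loop_iterate {n : ℕ} {ρ : Type} [DecidableEq ρ] (Q : QueryGraph n) {x y : ρ}
    {a : Prog ρ} {next : Store ρ → Store ρ} {c : ℕ}
    (hbody : ∀ τ f K σ, runCost Q τ f (a :: K) σ = c * τ + runCost Q τ f K (next σ))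
    (τ : ℝ≥0∞) (f : Store ρ → ℝ≥0∞) (K : List (Prog ρ)) (N : ℕ) (σ : Store ρ)
    (hlt : ∀ j < N, next^[j] σ x < next^[j] σ y) (hN : ¬next^[N] σ x < next^[N] σ y) :
    runCost Q τ f (.loop x y a :: K) σ =
      (((c + 1) * N + 1 : ℕ) : ℝ≥0∞) * τ + runCost Q τ f K (next^[N] σ) := by
  induction N generalizing σ with
  | zero =>
    rw [runCost_loop_neg Q τ f K σ hN]
    simp
  | succ N ih =>
    rw [runCost_loop_pos Q τ f K σ (hlt 0 (by omega)), hbody,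
      ih (next σ) (fun j hj => hlt (j + 1) (by omega)) hN]
    push_cast
    rw [Function.iterate_succ_apply]
    ring

/-! ### Estimate-high-edges: the parts of the program -/

/-- The body of the sampling loop. -/
def eheBody (S : Prog ℕ) : Prog EheReg :=
  .block [
    .op (.add (reg .i) (reg .i) (reg .one)),
    .op (.copy (sreg 0) (reg .n)),
    .op (.const (sreg 1) (1 / 10)),
    .op (.copy (sreg 2) (reg .δ')),
    S.map Sum.inl,
    .ite (sreg 3) (reg .one)
      (.block [
        .op (.const (reg .failed) 1),
        .op (.copy (reg .i) (reg .r))])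
      (.block [
        .op (.degree (reg .degU) (sreg 3)),
        .op (.degree (reg .degV) (sreg 4)),
        .ite (reg .thr) (reg .degU)
          (.ite (reg .thr) (reg .degV)
            (.op (.add (reg .count) (reg .count) (reg .one)))
            .skip)
          .skip])]

/-- The sampling loop. -/
def eheLoop (S : Prog ℕ) : Prog EheReg := .loop (reg .i) (reg .r) (eheBody S)

/-- What follows the sampling loop. -/
def eheFinish : Prog EheReg :=
  .block [
    .ite (reg .zero) (reg .failed)
      (.op (.const (reg .out) 0))
      (.block [
        .op (.div (reg .count) (reg .count) (reg .r)),
        .op (.const (reg .tmp) (26 / 10)),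
        .op (.mul (reg .tmp) (reg .tmp) (reg .ε)),
        .ite (reg .tmp) (reg .count)
          (.op (.const (reg .out) 1))
          (.op (.const (reg .out) 0))])]

/-- The values of the registers in the sampling loop. -/
structure EheState (n : ℕ) (ε δ' thr : ℝ) (r i c : ℕ) (σ : Store EheReg) : Prop where
  n : σ (reg .n) = n
  ε : σ (reg .ε) = ε
  δ' : σ (reg .δ') = δ'
  thr : σ (reg .thr) = thr
  zero : σ (reg .zero) = 0
  one : σ (reg .one) = 1
  r : σ (reg .r) = r
  i : σ (reg .i) = i
  count : σ (reg .count) = c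
  failed : σ (reg .failed) = 0

/-- One turn of the loop that computes `len`. -/
def eheLenNext (σ : Store EheReg) : Store EheReg :=
  Function.update (Function.update σ (reg .tmp) (σ (reg .tmp) * σ (reg .two))) (reg .len)
    (σ (reg .len) + σ (reg .one))

theorem eheLenNext_iterate (σ : Store EheReg) (h2 : σ (reg .two) = 2) (h1 : σ (reg .one) = 1)
    (h0 : σ (reg .len) = 0) (j : ℕ) :
    eheLenNext^[j] σ = Function.update (Function.update σ (reg .tmp) (σ (reg .tmp) * 2 ^ j))
      (reg .len) j := by
  induction j with
  | zero => simp [← h0]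
  | succ j ih =>
    rw [Function.iterate_succ_apply', ih]
    ext z
    simp only [eheLenNext, Function.update_apply]
    split_ifs <;> simp_all [pow_succ, mul_assoc]

/-- One turn of the loop that computes `r`. -/
def eheNumNext (σ : Store EheReg) : Store EheReg :=
  Function.update (Function.update σ (reg .r) (σ (reg .r) + σ (reg .one))) (reg .tmp)
    ((σ (reg .r) + σ (reg .one)) * σ (reg .ε))

theorem eheNumNext_iterate (σ : Store EheReg) (h1 : σ (reg .one) = 1)
    (h0 : σ (reg .r) = 0) (ht : σ (reg .tmp) = 0) (j : ℕ) :
    eheNumNext^[j] σ = Function.update (Function.update σ (reg .r) j) (reg .tmp)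
      (j * σ (reg .ε)) := by
  induction j with
  | zero =>
    ext z
    simp only [Function.iterate_zero, id_eq, Function.update_apply]
    split_ifs <;> simp_all
  | succ j ih =>
    rw [Function.iterate_succ_apply', ih]
    ext z
    simp only [eheNumNext, Function.update_apply]
    split_ifs <;> simp_all

/-- The number of doublings that bring `x` up to `y`. -/
theorem exists_doubling {x y : ℝ} (hx : 0 < x) (hxy : x < y) :
    ∃ ℓ : ℕ, 1 ≤ ℓ ∧ y ≤ x * 2 ^ ℓ ∧ x * 2 ^ ℓ < 2 * y ∧ ∀ j < ℓ, x * 2 ^ j < y := by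
  classical
  have hex : ∃ ℓ : ℕ, y ≤ x * 2 ^ ℓ := by
    obtain ⟨ℓ, h⟩ := pow_unbounded_of_one_lt (y / x) (one_lt_two (α := ℝ))
    refine ⟨ℓ, ?_⟩
    rw [div_lt_iff₀ hx] at h
    linarith
  have hlt : ∀ j < Nat.find hex, x * 2 ^ j < y := fun j hj => not_le.1 (Nat.find_min hex hj)
  have hpos : 1 ≤ Nat.find hex := by
    by_contra h
    have h0 : Nat.find hex = 0 := by omega
    have := Nat.find_spec hex
    rw [h0] at this
    simp only [pow_zero, mul_one] at this
    linarith
  refine ⟨Nat.find hex, hpos, Nat.find_spec hex, ?_, hlt⟩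
  have := hlt (Nat.find hex - 1) (by omega)
  have h2 : (2 : ℝ) ^ Nat.find hex = 2 ^ (Nat.find hex - 1) * 2 := by
    rw [← pow_succ]; congr 1; omega
  rw [h2]
  linarith

/-- Everything that precedes the sampling loop. -/
theorem ehe_setup {n : ℕ} (Q : QueryGraph n) (S : Prog ℕ) {α ε δ : ℝ} {σ : Store EheReg}
    (hε : 0 < ε) (hδ : 0 < δ) (hδ1 : δ < 1) (hσ : EheInput n α ε δ σ) :
    ∃ (ℓ r T : ℕ) (σ' : Store EheReg), 1 ≤ ℓ ∧ 2 ≤ δ * 2 ^ ℓ ∧ δ * 2 ^ ℓ < 4 ∧ 1 ≤ r ∧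
      100 * ℓ ≤ r * ε ∧ r * ε < 100 * ℓ + ε ∧ T ≤ 60 + 6 * ℓ + 6 * r ∧
      EheState n ε (δ / (2 * r)) (2 * α / ε) r 0 0 σ' ∧
      ∀ τ f, runCost Q τ f [estimateHighEdges S] σ =
        T * τ + runCost Q τ f [eheLoop S, eheFinish] σ' := by
  obtain ⟨ℓ, hℓ, hℓ2, hℓ4, hlt⟩ := exists_doubling hδ (show δ < 2 by linarith)
  have hℓr : (1 : ℝ) ≤ ℓ := by exact_mod_cast hℓ
  -- The second loop stops at the least `r` with `100ℓ ≤ rε`, which is this ceiling; `ℓ` is the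
  -- number of doublings made by the first loop.
  set r := ⌈100 * (ℓ : ℝ) / ε⌉₊ with hr
  have hr1 : 100 * (ℓ : ℝ) ≤ r * ε := by
    rw [← div_le_iff₀ hε]; exact Nat.le_ceil _
  have hr2 : (r : ℝ) * ε < 100 * ℓ + ε := by
    have := Nat.ceil_lt_add_one (show 0 ≤ 100 * (ℓ : ℝ) / ε by positivity)
    rw [← hr, ← lt_div_iff₀ hε, add_div, div_self hε.ne'] at *
    exact this
  have hrlt : ∀ j < r, (j : ℝ) * ε < 100 * ℓ := fun j hj => by
    rw [← lt_div_iff₀ hε]; exact Nat.lt_ceil.1 hj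
  have hr0 : 1 ≤ r := by
    by_contra h
    have : r = 0 := by omega
    rw [this] at hr1
    norm_num at hr1
    linarith
  obtain ⟨hn, hα', hε', hδ'⟩ := hσ
  set σ₁ : Store EheReg := Function.update (Function.update (Function.update (Function.update
    (Function.update σ (reg .zero) 0) (reg .one) 1) (reg .two) 2) (reg .len) 0) (reg .tmp) δ with h₁
  set σ₂ := Function.update (Function.update σ₁ (reg .tmp) (δ * 2 ^ ℓ)) (reg .len) ℓ with h₂
  set σ₃ : Store EheReg := Function.update (Function.update (Function.update (Function.update σ₂
    (reg .tmp) 100) (reg .len) (ℓ * 100)) (reg .r) 0) (reg .tmp) 0 with h₃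
  set σ₄ := Function.update (Function.update σ₃ (reg .r) r) (reg .tmp) (r * ε) with h₄
  set σ₅ : Store EheReg := Function.update (Function.update (Function.update (Function.update
    (Function.update (Function.update (Function.update σ₄ (reg .tmp) (2 * r)) (reg .δ')
    (δ / (2 * r))) (reg .tmp) (2 * α)) (reg .thr) (2 * α / ε)) (reg .count) 0) (reg .failed) 0)
    (reg .i) 0 with h₅
  have hit₂ : ∀ j, eheLenNext^[j] σ₁ = Function.update (Function.update σ₁ (reg .tmp)
      (δ * 2 ^ j)) (reg .len) j := by
    intro j
    rw [eheLenNext_iterate σ₁ (by simp [h₁]) (by simp [h₁]) (by simp [h₁])]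
    simp [h₁]
  have hit₄ : ∀ j, eheNumNext^[j] σ₃ = Function.update (Function.update σ₃ (reg .r) j) (reg .tmp)
      (j * ε) := by
    intro j
    rw [eheNumNext_iterate σ₃ (by simp [h₃, h₂, h₁]) (by simp [h₃]) (by simp [h₃])]
    simp [h₃, h₂, h₁, hε']
  have hbody₂ : ∀ τ f K σ, runCost Q τ f (Prog.block [
      .op (.mul (reg .tmp) (reg .tmp) (reg .two)),
      .op (.add (reg .len) (reg .len) (reg .one))] :: K) σ =
      (5 : ℕ) * τ + runCost Q τ f K (eheLenNext σ) := by
    intro τ f K σ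
    simp only [runCost_block_cons, runCost_block_nil, runCost_mul, runCost_addInstr, eheLenNext]
    simp [Function.update_of_ne]
    ring
  have hbody₄ : ∀ τ f K σ, runCost Q τ f (Prog.block [
      .op (.add (reg .r) (reg .r) (reg .one)),
      .op (.mul (reg .tmp) (reg .r) (reg .ε))] :: K) σ =
      (5 : ℕ) * τ + runCost Q τ f K (eheNumNext σ) := by
    intro τ f K σ
    simp only [runCost_block_cons, runCost_block_nil, runCost_mul, runCost_addInstr, eheNumNext]
    simp [Function.update_of_ne]
    ring
  -- A turn of either loop takes six steps, five for the body and one for the test; 37 counts all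
  -- the rest.
  refine ⟨ℓ, r, 37 + 6 * ℓ + 6 * r, σ₅, hℓ, hℓ2, by linarith, hr0, hr1, hr2, by omega, ?_,
    fun τ f => ?_⟩
  · constructor <;> simp [h₅, h₄, h₃, h₂, h₁, hn, hε']
  · simp only [estimateHighEdges, runCost_block_cons, runCost_const, runCost_copy]
    rw [show Function.update (Function.update (Function.update (Function.update
      (Function.update σ (reg .zero) ((0 : ℚ) : ℝ)) (reg .one) ((1 : ℚ) : ℝ)) (reg .two)
      ((2 : ℚ) : ℝ)) (reg .len) ((0 : ℚ) : ℝ)) (reg .tmp) _ = σ₁ by simp [h₁, hδ']]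
    rw [runCost_loop_iterate Q hbody₂ τ f _ ℓ σ₁
      (fun j hj => by rw [hit₂]; simpa [h₁] using hlt j hj) (by rw [hit₂]; simpa [h₁] using hℓ2),
      hit₂, ← h₂]
    simp only [runCost_block_cons, runCost_const, runCost_mul]
    rw [show Function.update (Function.update (Function.update (Function.update σ₂
      (reg .tmp) ((100 : ℚ) : ℝ)) (reg .len) _) (reg .r) ((0 : ℚ) : ℝ)) (reg .tmp)
      ((0 : ℚ) : ℝ) = σ₃ by simp [h₃, h₂]]
    rw [runCost_loop_iterate Q hbody₄ τ f _ r σ₃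
      (fun j hj => by rw [hit₄]; simpa [h₃, mul_comm] using hrlt j hj)
      (by rw [hit₄]; simpa [h₃, mul_comm] using hr1),
      hit₄, ← h₄]
    simp only [runCost_block_cons, runCost_const, runCost_mul, runCost_div]
    rw [show Function.update (Function.update (Function.update (Function.update
      (Function.update (Function.update (Function.update σ₄ (reg .tmp) _) (reg .δ') _) (reg .tmp) _)
      (reg .thr) _) (reg .count) ((0 : ℚ) : ℝ)) (reg .failed) ((0 : ℚ) : ℝ)) (reg .i)
      ((0 : ℚ) : ℝ) = σ₅ by simp [h₅, h₄, h₃, h₂, h₁, hα', hε', hδ']]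
    push_cast
    simp only [← add_assoc]
    congr 1
    ring

/-! ### Estimate-high-edges: the sampling loop -/

/-- The high edges. -/
def QueryGraph.highEdges {n : ℕ} (Q : QueryGraph n) (thr : ℝ) : Set (Sym2 (Fin n)) :=
  {e ∈ Q.graph.edgeSet | ∀ v ∈ e, thr < (Q.deg v : ℝ)}

/-- The stores in which an edge from `E` is returned. -/
def returnsEdgeIn {n : ℕ} (E : Set (Sym2 (Fin n))) : Set (Store ℕ) :=
  {s | ∃ e ∈ E, s ∈ returnsEdge e}

/-- What follows the call of the sampling procedure in the body of the loop. -/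
def eheTail : Prog EheReg :=
  .block [.ite (sreg 3) (reg .one)
    (.block [
      .op (.const (reg .failed) 1),
      .op (.copy (reg .i) (reg .r))])
    (.block [
      .op (.degree (reg .degU) (sreg 3)),
      .op (.degree (reg .degV) (sreg 4)),
      .ite (reg .thr) (reg .degU)
        (.ite (reg .thr) (reg .degV)
          (.op (.add (reg .count) (reg .count) (reg .one)))
          .skip)
        .skip])]

/-- The sampler works on its own registers only, so the contents `v` of the others are fixed before
the call, while `s'` may be anything after it. The 9 steps are four instructions and five unfoldings
of the block. -/
theorem EheState.call {n : ℕ} {ε δ' thr : ℝ} {r i c : ℕ} {σ : Store EheReg}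
    (h : EheState n ε δ' thr r i c σ) (Q : QueryGraph n) (S : Prog ℕ) (τ : ℝ≥0∞)
    (f : Store EheReg → ℝ≥0∞) (K : List (Prog EheReg)) :
    ∃ (s : Store ℕ) (v : Store Var), SamplerInput n (1 / 10) δ' s ∧
      (∀ s', EheState n ε δ' thr r (i + 1) c (Sum.elim s' v)) ∧
      runCost Q τ f (eheBody S :: K) σ = 9 * τ + runCost Q τ (fun s' =>
        runCost Q τ f (eheTail :: K) (Sum.elim s' v)) [S] s := by
  obtain ⟨hn, hε, hδ', hthr, hz, ho, hr, hi, hc, hf⟩ := h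
  set σ₁ : Store EheReg := Function.update (Function.update (Function.update (Function.update σ
    (reg .i) (i + 1)) (sreg 0) n) (sreg 1) (1 / 10)) (sreg 2) δ' with h₁
  refine ⟨σ₁ ∘ Sum.inl, σ₁ ∘ Sum.inr, ?_, ?_, ?_⟩
  · simp [SamplerInput, h₁]
  · intro s'
    constructor <;> simp [*]
  · simp only [eheBody, runCost_block_cons, runCost_const, runCost_copy, runCost_addInstr]
    rw [show Function.update (Function.update (Function.update (Function.update σ (reg .i) _)
      (sreg 0) _) (sreg 1) (((1 / 10 : ℚ)) : ℝ)) (sreg 2) _ = σ₁ by simp [h₁, hi, ho, hn, hδ'],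
      runCost_map_inl]
    simp only [← add_assoc]
    congr 1
    ring

theorem EheState.tail_edge {n : ℕ} {ε δ' thr : ℝ} {r i c : ℕ} {σ : Store EheReg}
    (h : EheState n ε δ' thr r i c σ) (Q : QueryGraph n) {u w : Fin n}
    (hu : σ (sreg 3) = vertexLabel u) (hw : σ (sreg 4) = vertexLabel w)
    (f : Store EheReg → ℝ≥0∞) (K : List (Prog EheReg)) :
    ∃ (σ' : Store EheReg) (c' : ℕ), EheState n ε δ' thr r i c' σ' ∧
      (thr < Q.deg u ∧ thr < Q.deg w → c' = c + 1) ∧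
      (¬(thr < Q.deg u ∧ thr < Q.deg w) → c' = c) ∧
      runCost Q 0 f (eheTail :: K) σ = runCost Q 0 f K σ' := by
  obtain ⟨hn, hε, hδ', hthr, hz, ho, hr, hi, hc, hf⟩ := h
  -- Labels start at 1, so comparing with 1 separates a returned vertex from the symbol 0.
  have hge : ¬σ (sreg 3) < σ (reg .one) := by
    rw [ho, hu]; exact not_lt.2 (one_le_vertexLabel u)
  set σ₁ : Store EheReg := Function.update (Function.update σ (reg .degU) (Q.deg u))
    (reg .degV) (Q.deg w) with h₁
  have key : runCost Q 0 f (eheTail :: K) σ = runCost Q 0 f (.ite (reg .thr) (reg .degU)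
      (.ite (reg .thr) (reg .degV) (.op (.add (reg .count) (reg .count) (reg .one))) .skip)
      .skip :: .block [] :: .block [] :: K) σ₁ := by
    simp only [eheTail, runCost_block_cons, runCost_ite_neg _ _ _ _ _ hge, runCost_degree,
      zero_add, hu, Q.degAnswer_vertexLabel]
    rw [Function.update_of_ne (by simp), hw, Q.degAnswer_vertexLabel]
  have hthr₁ : σ₁ (reg .thr) = thr := by simp [h₁, hthr]
  have hU : σ₁ (reg .degU) = Q.deg u := by simp [h₁]
  have hV : σ₁ (reg .degV) = Q.deg w := by simp [h₁]
  rw [key]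
  by_cases h1 : thr < Q.deg u
  · rw [runCost_ite_pos _ _ _ _ _ (by rwa [hthr₁, hU])]
    by_cases h2 : thr < Q.deg w
    · rw [runCost_ite_pos _ _ _ _ _ (by rwa [hthr₁, hV])]
      refine ⟨Function.update σ₁ (reg .count) (c + 1), c + 1, ?_, fun _ => rfl,
        fun h => (h ⟨h1, h2⟩).elim, ?_⟩
      · constructor <;> simp [*]
      · simp [runCost_addInstr, runCost_block_nil, h₁, hc, ho]
    · rw [runCost_ite_neg _ _ _ _ _ (by rwa [hthr₁, hV])]
      refine ⟨σ₁, c, ?_, fun h => (h2 h.2).elim, fun _ => rfl, ?_⟩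
      · constructor <;> simp [*]
      · simp [runCost_skip, runCost_block_nil]
  · rw [runCost_ite_neg _ _ _ _ _ (by rwa [hthr₁, hU])]
    refine ⟨σ₁, c, ?_, fun h => (h1 h.1).elim, fun _ => rfl, ?_⟩
    · constructor <;> simp [*]
    · simp [runCost_skip, runCost_block_nil]

theorem EheState.tail_noEdge {n : ℕ} {ε δ' thr : ℝ} {r i c : ℕ} {σ : Store EheReg}
    (h : EheState n ε δ' thr r i c σ) (Q : QueryGraph n) (S : Prog ℕ) (h0 : σ (sreg 3) = 0)
    (f : Store EheReg → ℝ≥0∞) :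
    ∃ σ' : Store EheReg, σ' (reg .out) = 0 ∧
      runCost Q 0 f [eheTail, eheLoop S, eheFinish] σ = f σ' := by
  have hlt : σ (sreg 3) < σ (reg .one) := by rw [h.one, h0]; exact one_pos
  simp only [eheTail, runCost_block_cons, runCost_block_nil, runCost_ite_pos _ _ _ _ _ hlt,
    runCost_const, runCost_copy, zero_add]
  rw [eheLoop, runCost_loop_neg _ _ _ _ _ (by simp), eheFinish,
    runCost_block_cons, runCost_ite_pos _ _ _ _ _ (by simp [h.zero])]
  simp only [runCost_const, runCost_block_nil, runCost_nil, zero_add]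
  exact ⟨_, by simp, rfl⟩

/-- Backward induction on the number `j` of remaining samples, with `Φ j c` as a bound on the
probability of a bad end from count `c`, and `φ` for the end without an edge. `hstep` is the
supermartingale condition for one call, `hend` and `hfail` are the boundary conditions. Writing `1 ≤
_ + Φ` avoids subtraction in `ℝ≥0∞` and makes failing to halt part of the bad event. -/
theorem ehe_loop_le_one_add {n : ℕ} {Q : QueryGraph n} {S : Prog ℕ} {ε δ' thr : ℝ} {r : ℕ}
    (f : Store EheReg → ℝ≥0∞) (Φ : ℕ → ℕ → ℝ≥0∞) (φ : ℝ≥0∞)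
    (hfail : ∀ σ : Store EheReg, σ (reg .out) = 0 → 1 ≤ f σ + φ)
    (hend : ∀ (c : ℕ) (σ : Store EheReg), (26 / 10 * ε < c / r → σ (reg .out) = 1) →
      (¬26 / 10 * ε < c / r → σ (reg .out) = 0) → 1 ≤ f σ + Φ 0 c)
    (hhalt : ∀ s, SamplerInput n (1 / 10) δ' s →
      haltProb Q S s (returnsSomeEdge Q ∪ returnsNoEdge) = 1)
    (hstep : ∀ j c s, SamplerInput n (1 / 10) δ' s →
      Φ j (c + 1) * haltProb Q S s (returnsEdgeIn (Q.highEdges thr)) +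
        Φ j c * haltProb Q S s (returnsEdgeIn (Q.graph.edgeSet \ Q.highEdges thr)) +
        φ * haltProb Q S s returnsNoEdge ≤ Φ (j + 1) c)
    (j i c : ℕ) (hij : i + j = r) (σ : Store EheReg) (hσ : EheState n ε δ' thr r i c σ) :
    1 ≤ runCost Q 0 f [eheLoop S, eheFinish] σ + Φ j c := by
  classical
  induction j generalizing i c σ with
  | zero =>
    obtain ⟨hn, hε, hδ', hthr, hz, ho, hr, hi, hc, hf⟩ := hσ
    rw [eheLoop, runCost_loop_neg _ _ _ _ _ (by rw [hi, hr, ← hij]; simp), eheFinish,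
      runCost_block_cons, runCost_ite_neg _ _ _ _ _ (by simp [hz, hf])]
    simp only [runCost_block_cons, runCost_const, runCost_mul, runCost_div, runCost_ite, zero_add]
    split_ifs with h
    all_goals
      simp only [runCost_const, runCost_block_nil, runCost_nil, zero_add]
      simp [hc, hr, hε] at h
      refine hend c _ ?_ ?_
      · intro h'; simp <;> linarith
      · intro h'; simp <;> linarith
  | succ j ih =>
    have hlt : σ (reg .i) < σ (reg .r) := by
      rw [hσ.i, hσ.r, ← hij]; push_cast; linarith
    rw [eheLoop, runCost_loop_pos _ _ _ _ _ hlt, zero_add]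
    obtain ⟨s, v, hs, hv, heq⟩ := hσ.call Q S 0 f [eheLoop S, eheFinish]
    rw [eheLoop] at heq
    rw [heq, mul_zero, zero_add, ← eheLoop]
    refine le_trans ?_ (add_le_add le_rfl (hstep j c s hs))
    -- The 1 on the left becomes the probability that the sampler halts with a valid outcome. All
    -- terms are then expectations over the same run, and the inequality can be checked store by
    -- store.
    rw [← hhalt s hs]
    simp only [haltProb_eq_runCost, ← runCost_zero_const_mul, ← runCost_zero_add]
    refine runCost_mono Q 0 (fun s' => ?_) _ _
    by_cases hs' : s' ∈ returnsSomeEdge Q ∪ returnsNoEdge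
    swap
    · simp [hs']
    rw [Set.indicator_of_mem hs', Pi.one_apply]
    rcases hs' with ⟨e, he, u, w, rfl, hu, hw⟩ | h0
    · -- an edge is returned
      obtain ⟨σ', c', hσ', hc1, hc2, heq'⟩ :=
        (hv s').tail_edge Q (u := u) (w := w) hu hw f [eheLoop S, eheFinish]
      have hret : s' ∈ returnsEdge s(u, w) := ⟨u, w, rfl, hu, hw⟩
      rw [heq']
      refine (ih (i + 1) c' (by omega) σ' hσ').trans ?_
      gcongr
      by_cases hh : thr < Q.deg u ∧ thr < Q.deg w
      · have hmem : s' ∈ returnsEdgeIn (Q.highEdges thr) := ⟨_, ⟨he, by simpa using hh⟩, hret⟩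
        rw [Set.indicator_of_mem hmem, hc1 hh, add_assoc]
        simp
      · have hmem : s' ∈ returnsEdgeIn (Q.graph.edgeSet \ Q.highEdges thr) :=
          ⟨_, ⟨he, fun h => hh (by simpa using h.2)⟩, hret⟩
        rw [Set.indicator_of_mem hmem, hc2 hh, add_right_comm]
        simp
    · -- no edge is returned
      obtain ⟨σ', hout, heq'⟩ := (hv s').tail_noEdge Q S h0 f
      rw [heq', Set.indicator_of_mem h0]
      refine (hfail σ' hout).trans ?_
      gcongr
      simp

/-! ### Estimate-high-edges: correctness -/

theorem indicator_one_le_one {α : Type*} (A : Set α) (a : α) :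
    A.indicator (1 : α → ℝ≥0∞) a ≤ 1 := by
  by_cases h : a ∈ A <;> simp [h]

theorem returnsEdge_unique {n : ℕ} {e e' : Sym2 (Fin n)} {s : Store ℕ} (h : s ∈ returnsEdge e)
    (h' : s ∈ returnsEdge e') : e = e' := by
  obtain ⟨u, v, rfl, hu, hv⟩ := h
  obtain ⟨u', v', rfl, hu', hv'⟩ := h'
  rw [vertexLabel_injective (hu.symm.trans hu'), vertexLabel_injective (hv.symm.trans hv')]

theorem not_returnsNoEdge {n : ℕ} {e : Sym2 (Fin n)} {s : Store ℕ} (h : s ∈ returnsEdge e) :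
    s ∉ returnsNoEdge := by
  obtain ⟨u, v, -, hu, -⟩ := h
  intro h0
  have := one_le_vertexLabel u
  rw [← hu, show s 3 = 0 from h0] at this
  linarith

/-- The events for different edges are disjoint because labels determine vertices, so their
indicators add up. -/
theorem haltProb_returnsEdgeIn {n : ℕ} (Q : QueryGraph n) (S : Prog ℕ) (s : Store ℕ)
    (E : Finset (Sym2 (Fin n))) :
    haltProb Q S s (returnsEdgeIn (E : Set (Sym2 (Fin n)))) =
      ∑ e ∈ E, haltProb Q S s (returnsEdge e) := by
  classical
  simp only [haltProb_eq_runCost]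
  rw [← runCost_zero_sum]
  congr 1
  funext s'
  by_cases h : s' ∈ returnsEdgeIn (E : Set (Sym2 (Fin n)))
  · obtain ⟨e, he, hs⟩ := h
    rw [Set.indicator_of_mem (s := returnsEdgeIn _) ⟨e, he, hs⟩, Finset.sum_eq_single_of_mem e he]
    · simp [hs]
    · intro e' _ hne
      exact Set.indicator_of_notMem (fun h' => hne (returnsEdge_unique h' hs)) _
  · rw [Set.indicator_of_notMem h, Finset.sum_eq_zero]
    intro e he
    exact Set.indicator_of_notMem (fun h' => h ⟨e, he, h'⟩) _

theorem haltProb_le_one {n : ℕ} {ρ : Type} [DecidableEq ρ] (Q : QueryGraph n) (P : Prog ρ)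
    (σ : Store ρ) (A : Set (Store ρ)) : haltProb Q P σ A ≤ 1 := by
  rw [haltProb_eq_runCost]
  exact runCost_zero_le Q (indicator_one_le_one A) _ _

/-- The probabilities of the outcomes of a call of an almost uniform sampler. -/
theorem SamplesAlmostUniformly.outcomes {S : Prog ℕ} {η : ℝ} (hS : SamplesAlmostUniformly S η)
    {n : ℕ} {Q : QueryGraph n} {δ : ℝ} {s : Store ℕ} (hm : 0 < Q.numEdges) (hδ : 0 < δ)
    (hδ1 : δ < 1) (hη : 0 ≤ η) (hη1 : η ≤ 1) (hs : SamplerInput n η δ s) (thr : ℝ) :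
    ∃ h l z : ℝ, 0 ≤ h ∧ 0 ≤ l ∧ 0 ≤ z ∧
      haltProb Q S s (returnsEdgeIn (Q.highEdges thr)) = ENNReal.ofReal h ∧
      haltProb Q S s (returnsEdgeIn (Q.graph.edgeSet \ Q.highEdges thr)) = ENNReal.ofReal l ∧
      haltProb Q S s returnsNoEdge = ENNReal.ofReal z ∧ h + l + z ≤ 1 ∧ z ≤ δ ∧
      (1 - η) * ((Q.highEdges thr).ncard / Q.numEdges) ≤ h ∧
      h ≤ (1 + η) * ((Q.highEdges thr).ncard / Q.numEdges) := by
  classical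
  obtain ⟨-, hsome, hedge⟩ := hS n Q δ s hm hδ hδ1 hs
  have hne := fun A => ((haltProb_le_one Q S s A).trans_lt ENNReal.one_lt_top).ne
  have hsum : haltProb Q S s (returnsEdgeIn (Q.highEdges thr)) +
      haltProb Q S s (returnsEdgeIn (Q.graph.edgeSet \ Q.highEdges thr)) +
      haltProb Q S s returnsNoEdge ≤ 1 := by
    simp only [haltProb_eq_runCost, ← runCost_zero_add]
    refine runCost_zero_le Q (fun s' => ?_) _ _
    by_cases h1 : s' ∈ returnsEdgeIn (Q.highEdges thr)
    · obtain ⟨e, he, hs'⟩ := h1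
      rw [Set.indicator_of_notMem (not_returnsNoEdge hs'), Set.indicator_of_notMem
        (s := returnsEdgeIn (Q.graph.edgeSet \ Q.highEdges thr))]
      · simpa using indicator_one_le_one (returnsEdgeIn (Q.highEdges thr)) s'
      · rintro ⟨e', he', hs''⟩
        exact he'.2 (returnsEdge_unique hs' hs'' ▸ he)
    · rw [Set.indicator_of_notMem h1, zero_add]
      by_cases h2 : s' ∈ returnsEdgeIn (Q.graph.edgeSet \ Q.highEdges thr)
      · obtain ⟨e, he, hs'⟩ := h2
        rw [Set.indicator_of_notMem (not_returnsNoEdge hs'), add_zero]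
        exact indicator_one_le_one _ s'
      · rw [Set.indicator_of_notMem h2, zero_add]
        exact indicator_one_le_one _ s'
  have hle : haltProb Q S s (returnsSomeEdge Q) ≤
      haltProb Q S s (returnsEdgeIn (Q.highEdges thr)) +
      haltProb Q S s (returnsEdgeIn (Q.graph.edgeSet \ Q.highEdges thr)) := by
    simp only [haltProb_eq_runCost, ← runCost_zero_add]
    refine runCost_mono Q 0 (fun s' => ?_) _ _
    by_cases h : s' ∈ returnsSomeEdge Q
    · obtain ⟨e, he, hs'⟩ := h
      by_cases h1 : e ∈ Q.highEdges thr
      · rw [Set.indicator_of_mem (s := returnsEdgeIn (Q.highEdges thr)) ⟨e, h1, hs'⟩]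
        exact (indicator_one_le_one _ s').trans le_self_add
      · rw [Set.indicator_of_mem (s := returnsEdgeIn (Q.graph.edgeSet \ _)) ⟨e, ⟨he, h1⟩, hs'⟩]
        exact (indicator_one_le_one _ s').trans le_add_self
    · simp [h]
  have hm' : (0 : ℝ) < Q.numEdges := by exact_mod_cast hm
  have hfin : (Q.highEdges thr).Finite := Set.toFinite _
  have hcard : (Q.highEdges thr).ncard = hfin.toFinset.card := Set.ncard_eq_toFinset_card _ hfin
  have hhigh : haltProb Q S s (returnsEdgeIn (Q.highEdges thr)) =
      ∑ e ∈ hfin.toFinset, haltProb Q S s (returnsEdge e) := by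
    rw [← haltProb_returnsEdgeIn, hfin.coe_toFinset]
  have hbnd : ∀ e ∈ hfin.toFinset, _ := fun e he => hedge e ((hfin.mem_toFinset.1 he).1)
  have hlow : ENNReal.ofReal ((1 - η) * ((Q.highEdges thr).ncard / Q.numEdges)) ≤
      haltProb Q S s (returnsEdgeIn (Q.highEdges thr)) := by
    rw [hhigh]
    refine le_trans (le_of_eq ?_) (Finset.sum_le_sum fun e he => (hbnd e he).1)
    rw [Finset.sum_const, hcard, nsmul_eq_mul, ← ENNReal.ofReal_natCast, ← ENNReal.ofReal_mul
      (by positivity)]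
    congr 1
    ring
  have hupp : haltProb Q S s (returnsEdgeIn (Q.highEdges thr)) ≤
      ENNReal.ofReal ((1 + η) * ((Q.highEdges thr).ncard / Q.numEdges)) := by
    rw [hhigh]
    refine le_trans (Finset.sum_le_sum fun e he => (hbnd e he).2) (le_of_eq ?_)
    rw [Finset.sum_const, hcard, nsmul_eq_mul, ← ENNReal.ofReal_natCast, ← ENNReal.ofReal_mul
      (by positivity)]
    congr 1
    ring
  have h1η : 0 ≤ 1 - η := by linarith
  refine ⟨_, _, _, ENNReal.toReal_nonneg, ENNReal.toReal_nonneg, ENNReal.toReal_nonneg,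
    (ENNReal.ofReal_toReal (hne _)).symm, (ENNReal.ofReal_toReal (hne _)).symm,
    (ENNReal.ofReal_toReal (hne _)).symm, ?_, ?_, ?_, ?_⟩
  · rw [← ENNReal.toReal_add (hne _) (hne _), ← ENNReal.toReal_add (by simp [hne]) (hne _)]
    exact ENNReal.toReal_le_of_le_ofReal zero_le_one (by simpa using hsum)
  · have h2 : ENNReal.ofReal (1 - δ) + haltProb Q S s returnsNoEdge ≤ 1 :=
      le_trans (by gcongr; exact hsome.trans hle) hsum
    have h3 := ENNReal.toReal_mono ENNReal.one_ne_top h2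
    rw [ENNReal.toReal_add ENNReal.ofReal_ne_top (hne _), ENNReal.toReal_ofReal (by linarith),
      ENNReal.toReal_one] at h3
    linarith
  · exact (ENNReal.ofReal_le_iff_le_toReal (hne _)).1 hlow
  · exact ENNReal.toReal_le_of_le_ofReal (by positivity) hupp

/-- `exp (-ℓ)`-type bounds from the number of samples. -/
theorem exp_le_half_of_doubling {δ x : ℝ} {ℓ : ℕ} (h2 : 2 ≤ δ * 2 ^ ℓ) (hx : x ≤ -ℓ) :
    Real.exp x ≤ δ / 2 := by
  have h : Real.exp x ≤ (2 ^ ℓ : ℝ)⁻¹ := by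
    rw [← Real.exp_log (show (0 : ℝ) < (2 ^ ℓ)⁻¹ by positivity), Real.exp_le_exp, Real.log_inv,
      Real.log_pow]
    -- Since `log 2 < 1`, `exp (-ℓ)` is at most `2 ^ (-ℓ)`.
    have := Real.log_two_lt_d9
    nlinarith [(Nat.cast_nonneg ℓ : (0 : ℝ) ≤ ℓ)]
  refine h.trans ?_
  rw [inv_le_iff_one_le_mul₀ (by positivity)]
  linarith

theorem ofReal_one_sub_le {p : ℝ≥0∞} {a δ : ℝ} (h : 1 ≤ p + ENNReal.ofReal a) (ha : a ≤ δ)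
    (hδ : 0 ≤ δ) : ENNReal.ofReal (1 - δ) ≤ p := by
  rw [ENNReal.ofReal_sub _ hδ, ENNReal.ofReal_one, tsub_le_iff_right]
  exact h.trans (by gcongr)

theorem ofReal_mul_add_le {a b c x y z w : ℝ} (ha : 0 ≤ a) (hb : 0 ≤ b) (hc : 0 ≤ c) (hx : 0 ≤ x)
    (hy : 0 ≤ y) (hz : 0 ≤ z) (h : a * x + b * y + c * z ≤ w) :
    ENNReal.ofReal a * ENNReal.ofReal x + ENNReal.ofReal b * ENNReal.ofReal y +
      ENNReal.ofReal c * ENNReal.ofReal z ≤ ENNReal.ofReal w := by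
  rw [← ENNReal.ofReal_mul ha, ← ENNReal.ofReal_mul hb, ← ENNReal.ofReal_mul hc,
    ← ENNReal.ofReal_add (by positivity) (by positivity),
    ← ENNReal.ofReal_add (by positivity) (by positivity)]
  exact ENNReal.ofReal_le_ofReal h

/-- Three applications of `ehe_loop_le_one_add`: the zero potential shows that an answer is always
reached, and two exponential-moment potentials, with bases 9/10 and 11/10 per high edge, bound the
lower and the upper tail of the count. -/
theorem ehe_correct {S : Prog ℕ} (hS : SamplesAlmostUniformly S (1 / 10)) {n : ℕ}
    {Q : QueryGraph n} {α ε δ : ℝ} {σ : Store EheReg} (hm : 0 < Q.numEdges) (hε : 0 < ε)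
    (hδ : 0 < δ) (hδ1 : δ < 1) (hσ : EheInput n α ε δ σ) :
    haltProb Q (estimateHighEdges S) σ (answersMany ∪ answersFew) = 1 ∧
      (4 * ε * Q.numEdges < (Q.numHighEdges α ε : ℝ) →
        ENNReal.ofReal (1 - δ) ≤ haltProb Q (estimateHighEdges S) σ answersMany) ∧
      ((Q.numHighEdges α ε : ℝ) ≤ 2 * ε * Q.numEdges →
        ENNReal.ofReal (1 - δ) ≤ haltProb Q (estimateHighEdges S) σ answersFew) := by
  classical
  obtain ⟨ℓ, r, T, σ', hℓ, hℓ2, -, hr, hr1, -, -, hσ', heq⟩ := ehe_setup Q S hε hδ hδ1 hσ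
  have hrpos : (1 : ℝ) ≤ r := by exact_mod_cast hr
  have hℓpos : (1 : ℝ) ≤ ℓ := by exact_mod_cast hℓ
  have hm' : (0 : ℝ) < Q.numEdges := by exact_mod_cast hm
  set δ' := δ / (2 * r) with hδ'
  have hδ'0 : 0 < δ' := by positivity
  have hδ'1 : δ' < 1 := by
    rw [hδ', div_lt_one (by positivity)]; linarith
  have hrδ : r * δ' = δ / 2 := by rw [hδ']; field_simp
  have hhalt : ∀ s, SamplerInput n (1 / 10) δ' s →
      haltProb Q S s (returnsSomeEdge Q ∪ returnsNoEdge) = 1 :=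
    fun s hs => (hS n Q δ' s hm hδ'0 hδ'1 hs).1
  have hout : ∀ s, SamplerInput n (1 / 10) δ' s → _ := fun s hs =>
    hS.outcomes hm hδ'0 hδ'1 (by norm_num) (by norm_num) hs (2 * α / ε)
  have hnum : (Q.highEdges (2 * α / ε)).ncard = Q.numHighEdges α ε := rfl
  simp only [haltProb_eq_runCost _ (estimateHighEdges S), heq, mul_zero, zero_add]
  refine ⟨?_, fun hmany => ?_, fun hfew => ?_⟩
  · refine le_antisymm (runCost_zero_le Q (indicator_one_le_one _) _ _) ?_
    have := ehe_loop_le_one_add (Q := Q) (S := S) ((answersMany ∪ answersFew).indicator 1)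
      (fun _ _ => 0) 0 (thr := 2 * α / ε) (ε := ε) (r := r) (δ' := δ') ?_ ?_ hhalt ?_ r 0 0 (by simp)
      σ' hσ'
    · simpa using this
    · intro σ h
      rw [Set.indicator_of_mem (show σ ∈ answersMany ∪ answersFew from Or.inr h)]; simp
    · intro c σ h1 h2
      rw [Set.indicator_of_mem]
      · simp
      · by_cases h : 26 / 10 * ε < c / r
        · exact Or.inl (h1 h)
        · exact Or.inr (h2 h)
    · intro j c s _; simp
  · have hq : 4 * ε < (Q.highEdges (2 * α / ε)).ncard / Q.numEdges := by
      rw [lt_div_iff₀ hm', hnum]; exact hmany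
    have hexp : Real.exp (-Real.log (10 / 9)) = 9 / 10 := by
      rw [Real.exp_neg, Real.exp_log (by norm_num)]; norm_num
    have hlog : 0 ≤ Real.log (10 / 9) := Real.log_nonneg (by norm_num)
    have hlog' : Real.log (10 / 9) ≤ 1 / 9 :=
      (Real.log_le_sub_one_of_pos (by norm_num)).trans (by norm_num)
    set lam := Real.log (10 / 9)
    -- The term `j * δ'` pays for a remaining call returning no edge, after which the answer FEW is
    -- wrong (`φ = 1`). The exponential is at least 1 if the final count misses the threshold.
    have := ehe_loop_le_one_add (Q := Q) (S := S) (answersMany.indicator 1)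
      (fun j c => ENNReal.ofReal (j * δ' +
        Real.exp (lam * (26 / 10 * ε * r - c) - 36 / 100 * ε * j))) 1
      (thr := 2 * α / ε) (ε := ε) (r := r) (δ' := δ') ?_ ?_ hhalt ?_ r 0 0 (by simp) σ' hσ'
    · refine ofReal_one_sub_le this ?_ hδ.le
      have := exp_le_half_of_doubling (x := lam * (26 / 10 * ε * r - (0 : ℕ)) - 36 / 100 * ε * r)
        hℓ2 ?_
      · linarith
      -- With `lam ≤ 1/9` the exponent is at most `(2.6/9 - 0.36) * ε * r < -0.07 * ε * r ≤ -7ℓ`.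
      · push_cast
        nlinarith [mul_nonneg hε.le (by linarith : (0 : ℝ) ≤ r)]
    · intro σ _; exact le_add_self
    · intro c σ h1 _
      by_cases h : 26 / 10 * ε < c / r
      · rw [Set.indicator_of_mem (show σ ∈ answersMany from h1 h)]; simp
      · refine le_trans ?_ le_add_self
        rw [ENNReal.one_le_ofReal]
        have hc : 0 ≤ 26 / 10 * ε * r - c := by
          rw [not_lt, div_le_iff₀ (by linarith)] at h; linarith
        have : 1 ≤ Real.exp (lam * (26 / 10 * ε * r - c) - 36 / 100 * ε * (0 : ℕ)) := by
          rw [Real.one_le_exp_iff]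
          simpa using mul_nonneg hlog hc
        simpa using this
    · intro j c s hs
      obtain ⟨h, l, z, hh, hl, hz, e1, e2, e3, hsum, hzδ, hlo, -⟩ := hout s hs
      rw [e1, e2, e3, ← ENNReal.ofReal_one]
      set x := Real.exp (lam * (26 / 10 * ε * r - c) - 36 / 100 * ε * j) with hx
      have hx0 : 0 < x := Real.exp_pos _
      have hx1 : Real.exp (lam * (26 / 10 * ε * r - (c + 1 : ℕ)) - 36 / 100 * ε * j) =
          9 / 10 * x := by
        rw [hx, ← hexp, ← Real.exp_add]; congr 1; push_cast; ring
      have hx2 : Real.exp (lam * (26 / 10 * ε * r - c) - 36 / 100 * ε * (j + 1 : ℕ)) =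
          Real.exp (-(36 / 100 * ε)) * x := by
        rw [hx, ← Real.exp_add]; congr 1; push_cast; ring
      have hx3 : 1 - 36 / 100 * ε ≤ Real.exp (-(36 / 100 * ε)) := by
        have := Real.add_one_le_exp (-(36 / 100 * ε)); linarith
      refine ofReal_mul_add_le (by positivity) (by positivity) zero_le_one hh hl hz ?_
      rw [hx1, hx2]
      push_cast
      -- As `h + l ≤ 1` and `h ≥ 0.9 * 4ε`, the left side is at most `1 - h / 10 ≤ 1 - 0.36ε`; this
      -- is the source of 36/100.
      have h5 : 9 / 10 * h + l ≤ Real.exp (-(36 / 100 * ε)) := by linarith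
      have h6 : (9 / 10 * h + l) * x ≤ Real.exp (-(36 / 100 * ε)) * x := by gcongr
      have h7 : (h + l) * (j * δ') ≤ 1 * (j * δ') := by gcongr; linarith
      linarith
  · have hq : (Q.highEdges (2 * α / ε)).ncard / Q.numEdges ≤ 2 * ε := by
      rw [div_le_iff₀ hm', hnum]; exact hfew
    have hexp : Real.exp (Real.log (11 / 10)) = 11 / 10 := Real.exp_log (by norm_num)
    have hlog : 1 / 11 ≤ Real.log (11 / 10) := by
      have := Real.one_sub_inv_le_log_of_pos (show (0 : ℝ) < 11 / 10 by norm_num)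
      linarith
    set mu := Real.log (11 / 10)
    -- Here a missing edge leads to the right answer, so `φ = 0` and no term in `δ'` is needed.
    have := ehe_loop_le_one_add (Q := Q) (S := S) (answersFew.indicator 1)
      (fun j c => ENNReal.ofReal
        (Real.exp (mu * (c - 26 / 10 * ε * r) + 22 / 100 * ε * j))) 0
      (thr := 2 * α / ε) (ε := ε) (r := r) (δ' := δ') ?_ ?_ hhalt ?_ r 0 0 (by simp) σ' hσ'
    · refine ofReal_one_sub_le this ?_ hδ.le
      have := exp_le_half_of_doubling (x := mu * ((0 : ℕ) - 26 / 10 * ε * r) + 22 / 100 * ε * r)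
        hℓ2 ?_
      · linarith
      -- The margin is narrower on this side: the exponent is at most `(0.22 - 2.6/11) * ε * r <
      -- -0.016 * ε * r ≤ -1.6ℓ`. This is where the factor 100 in `r` is needed.
      · push_cast
        nlinarith [mul_nonneg hε.le (by linarith : (0 : ℝ) ≤ r)]
    · intro σ h
      rw [Set.indicator_of_mem (show σ ∈ answersFew from h)]; simp
    · intro c σ _ h2
      by_cases h : 26 / 10 * ε < c / r
      · refine le_trans ?_ le_add_self
        rw [ENNReal.one_le_ofReal, Real.one_le_exp_iff]
        have hc : 0 ≤ c - 26 / 10 * ε * r := by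
          rw [lt_div_iff₀ (by linarith)] at h; linarith
        simpa using mul_nonneg (by linarith : 0 ≤ mu) hc
      · rw [Set.indicator_of_mem (show σ ∈ answersFew from h2 h)]; simp
    · intro j c s hs
      obtain ⟨h, l, z, hh, hl, hz, e1, e2, e3, hsum, hzδ, -, hup⟩ := hout s hs
      rw [e1, e2, e3, ← ENNReal.ofReal_zero]
      set x := Real.exp (mu * (c - 26 / 10 * ε * r) + 22 / 100 * ε * j) with hx
      have hx0 : 0 < x := Real.exp_pos _
      have hx1 : Real.exp (mu * ((c + 1 : ℕ) - 26 / 10 * ε * r) + 22 / 100 * ε * j) =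
          11 / 10 * x := by
        rw [hx, ← hexp, ← Real.exp_add]; congr 1; push_cast; ring
      have hx2 : Real.exp (mu * (c - 26 / 10 * ε * r) + 22 / 100 * ε * (j + 1 : ℕ)) =
          Real.exp (22 / 100 * ε) * x := by
        rw [hx, ← Real.exp_add]; congr 1; push_cast; ring
      have hx3 : 22 / 100 * ε + 1 ≤ Real.exp (22 / 100 * ε) := Real.add_one_le_exp _
      refine ofReal_mul_add_le (Real.exp_pos _).le hx0.le le_rfl hh hl hz ?_
      rw [hx1, hx2]
      -- The left side is at most `1 + h / 10`, and `h ≤ 1.1 * 2ε`.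
      have h5 : 11 / 10 * h + l ≤ Real.exp (22 / 100 * ε) := by linarith
      have h6 : (11 / 10 * h + l) * x ≤ Real.exp (22 / 100 * ε) * x := by gcongr
      linarith

/-! ### An almost uniform edge sampler: a single trial

A vertex is heavy if its degree exceeds a threshold `θ`. A trial picks a random vertex `u` and a
random number `j ≤ θ`. If `u` is not heavy and has a `j`-th neighbor `w`, then, depending on the
toss of a coin, the trial either returns the edge `uw`, or, provided that `w` is heavy, returns a
random edge at `w`. -/

/-- The part of a trial that follows the choice of an edge at a vertex that is not heavy. -/
def samplerFound : Prog ℕ :=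
  .block [
    .op (.const 8 2),
    .op (.rand 16 8),
    .ite 5 16
      (.block [
        .op (.degree 14 15),
        .ite 11 14
          (.block [
            .op (.rand 13 14),
            .op (.neighbor 16 15 13),
            .op (.copy 3 15),
            .op (.copy 4 16),
            .op (.copy 10 9)])
          .skip])
      (.block [
        .op (.copy 3 12),
        .op (.copy 4 15),
        .op (.copy 10 9)])]

/-- Trial number `k`, where register `10` holds `k - 1` and the threshold is the content of register
`9` divided by `k`. After a success, the content of register `9` is copied into register `10`. -/
def samplerTrial : Prog ℕ :=
  .block [
    .op (.add 10 10 5),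
    .op (.div 11 9 10),
    .op (.rand 12 0),
    .op (.rand 13 11),
    .op (.degree 14 12),
    .op (.neighbor 15 12 13),
    .ite 11 14 .skip (.ite 15 5 .skip samplerFound)]

/-- The store after `k` unsuccessful trials. -/
structure SamplerState (n : ℕ) (A : ℝ) (k : ℕ) (σ : Store ℕ) : Prop where
  n : σ 0 = n
  one : σ 5 = 1
  total : σ 9 = A
  trials : σ 10 = k
  result : σ 3 = 0

/-- The store after a successful trial. -/
structure SamplerDone {n : ℕ} (A : ℝ) (a b : Fin n) (σ : Store ℕ) : Prop where
  total : σ 9 = A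
  trials : σ 10 = A
  fst : σ 3 = vertexLabel a
  snd : σ 4 = vertexLabel b

section Trial

variable {n : ℕ} (Q : QueryGraph n) (θ : ℝ) (g : Fin n → Fin n → ℝ≥0∞) (v : ℝ≥0∞)

open Classical in
/-- The expected outcome of a trial that tries to return an edge at `w`. -/
def secondValue (w : Fin n) : ℝ≥0∞ :=
  if θ < Q.deg w then (Q.deg w : ℝ≥0∞)⁻¹ * ∑ j : Fin (Q.deg w), g w (Q.nbr w j) else v

open Classical in
/-- The expected outcome of a trial that chooses the vertex `u` and the number `j + 1`. -/
def choiceValue (u : Fin n) (j : ℕ) : ℝ≥0∞ :=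
  if θ < Q.deg u then v
  else if h : j < Q.deg u then
    2⁻¹ * (g u (Q.nbr u ⟨j, h⟩) + secondValue Q θ g v (Q.nbr u ⟨j, h⟩))
  else v

/-- The expected outcome of a trial, where an edge `ab` is worth `g a b` and a failure `v`. -/
def trialValue : ℝ≥0∞ :=
  (n : ℝ≥0∞)⁻¹ * ∑ u : Fin n, (⌊θ⌋₊ : ℝ≥0∞)⁻¹ * ∑ j : Fin ⌊θ⌋₊, choiceValue Q θ g v u j

/-- The continuation enters only through its value `v` after a failure and `g a b` after returning
`ab`, so the same computation serves both probabilities and time. -/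
theorem runCost_samplerFound {A : ℝ} {k : ℕ} {F : Store ℕ → ℝ≥0∞} {K : List (Prog ℕ)}
    (hv : ∀ σ, SamplerState n A k σ → runCost Q 0 F K σ = v)
    (hg : ∀ a b σ, SamplerDone A a b σ → runCost Q 0 F K σ = g a b)
    {σ : Store ℕ} (hσ : SamplerState n A k σ) (hθ0 : 0 ≤ θ) (hθ : σ 11 = θ) {u w : Fin n}
    (hu : σ 12 = vertexLabel u) (hw : σ 15 = vertexLabel w) :
    runCost Q 0 F (samplerFound :: K) σ = 2⁻¹ * (g u w + secondValue Q θ g v w) := by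
  obtain ⟨h0, h5, h9, h10, h3⟩ := hσ
  simp only [samplerFound, runCost_block_cons, runCost_const, zero_add]
  rw [runCost_rand (N := 2) _ _ _ _ _ _ _ (by norm_num) (by simp)]
  rw [zero_add, Fin.sum_univ_two]
  congr 2
  -- The coin shows 1 and the test `1 < coin` fails: the edge from the light vertex is returned. The
  -- other bullet is the move to `w`.
  · rw [runCost_block_cons, zero_add, runCost_ite_neg _ _ _ _ _ (by simp [h5])]
    simp only [runCost_block_cons, runCost_block_nil, runCost_copy, zero_add]
    refine hg u w _ ?_
    constructor <;> simp [*]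
  · rw [runCost_block_cons, zero_add, runCost_ite_pos _ _ _ _ _ (by simp [h5])]
    simp only [runCost_block_cons, runCost_degree, zero_add]
    by_cases hd : θ < Q.deg w
    · rw [runCost_ite_pos _ _ _ _ _ (by simpa [hw, hθ, Q.degAnswer_vertexLabel] using hd)]
      have hdpos : 0 < Q.deg w := by
        have : (0 : ℝ) < Q.deg w := hθ0.trans_lt hd
        exact_mod_cast this
      simp only [runCost_block_cons, zero_add]
      rw [runCost_rand (N := Q.deg w) _ _ _ _ _ _ _ hdpos
        (by simp [hw, Q.degAnswer_vertexLabel]), secondValue, if_pos hd, zero_add]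
      congr 1
      refine Finset.sum_congr rfl fun j _ => ?_
      simp only [runCost_block_cons, runCost_block_nil, runCost_copy, runCost_neighbor, zero_add]
      refine hg w (Q.nbr w j) _ ?_
      constructor <;> simp [*, Q.nbrAnswer_vertexLabel]
    · rw [runCost_ite_neg _ _ _ _ _ (by simpa [hw, hθ, Q.degAnswer_vertexLabel] using hd),
        runCost_skip, runCost_block_nil, runCost_block_nil, secondValue,
        if_neg hd]
      simp only [zero_add]
      refine hv _ ?_
      constructor <;> simp [*]

theorem runCost_samplerTrial {A : ℝ} {k : ℕ} {F : Store ℕ → ℝ≥0∞} {K : List (Prog ℕ)}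
    (hv : ∀ σ, SamplerState n A (k + 1) σ → runCost Q 0 F K σ = v)
    (hg : ∀ a b σ, SamplerDone A a b σ → runCost Q 0 F K σ = g a b)
    {σ : Store ℕ} (hσ : SamplerState n A k σ) (hn : 0 < n) (hθ : 1 ≤ A / (k + 1)) :
    runCost Q 0 F (samplerTrial :: K) σ = trialValue Q (A / (k + 1)) g v := by
  obtain ⟨h0, h5, h9, h10, h3⟩ := hσ
  simp only [samplerTrial, runCost_block_cons, runCost_addInstr, runCost_div, zero_add]
  rw [runCost_rand (N := n) _ _ _ _ _ _ _ hn (by simp [h0]), zero_add, trialValue]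
  congr 1
  refine Finset.sum_congr rfl fun u _ => ?_
  simp only [runCost_block_cons, zero_add]
  rw [runCost_rand (N := ⌊A / (k + 1)⌋₊) _ _ _ _ _ _ _ (Nat.floor_pos.2 hθ)
    (by simp [h9, h10, h5]), zero_add]
  congr 1
  refine Finset.sum_congr rfl fun j _ => ?_
  simp only [runCost_block_cons, runCost_degree, runCost_neighbor, zero_add]
  have hul : ((u : ℕ) : ℝ) + 1 = vertexLabel u := rfl
  set σ' : Store ℕ := Function.update (Function.update (Function.update (Function.update
    (Function.update (Function.update σ 10 (k + 1)) 11 (A / (k + 1))) 12 (vertexLabel u)) 13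
    ((j : ℝ) + 1)) 14 (Q.deg u)) 15 (Q.nbrAnswer (vertexLabel u) ((j : ℝ) + 1)) with hσ'
  have hs : SamplerState n A (k + 1) σ' := by
    constructor <;> simp [*]
  have hfin : ∀ K', runCost Q 0 F (K' :: .block [] :: K) σ' = runCost Q 0 F (K' :: K) σ' := by
    intro K'
    rw [runCost_cons_eq, runCost_cons_eq Q 0 F K' K]
    congr 1
    funext σ
    rw [runCost_block_nil, zero_add]
  rw [show Function.update (Function.update (Function.update (Function.update
    (Function.update (Function.update σ 10 _) 11 _) 12 _) 13 _) 14 _) 15 _ = σ' by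
      simp [hσ', h10, h5, h9, hul, Q.degAnswer_vertexLabel]]
  rw [hfin, choiceValue]
  have h11 : σ' 11 = A / (k + 1) := by simp [hσ']
  have h14 : σ' 14 = Q.deg u := by simp [hσ']
  have h15 : σ' 15 = Q.nbrAnswer (vertexLabel u) ((j : ℝ) + 1) := by simp [hσ']
  by_cases hd : A / (k + 1) < Q.deg u
  · rw [runCost_ite_pos _ _ _ _ _ (by rwa [h11, h14]), if_pos hd, runCost_skip, zero_add, zero_add]
    exact hv _ hs
  · rw [runCost_ite_neg _ _ _ _ _ (by rwa [h11, h14]), if_neg hd, zero_add]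
    by_cases hj : (j : ℕ) < Q.deg u
    · rw [dif_pos hj]
      have hnb : σ' 15 = vertexLabel (Q.nbr u ⟨j, hj⟩ : Fin n) := by
        rw [h15]; exact Q.nbrAnswer_vertexLabel u ⟨j, hj⟩
      rw [runCost_ite_neg _ _ _ _ _ (by rw [hnb, hs.one]; exact not_lt.2 (one_le_vertexLabel _)),
        zero_add]
      exact runCost_samplerFound Q _ g v hv hg hs (zero_le_one.trans hθ) h11 (by simp [hσ']) hnb
    · rw [dif_neg hj]
      have hnb : σ' 15 = 0 := by rw [h15]; exact Q.nbrAnswer_of_le u j (not_lt.1 hj)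
      rw [runCost_ite_pos _ _ _ _ _ (by rw [hnb, hs.one]; exact one_pos), runCost_skip, zero_add,
        zero_add]
      exact hv _ hs

end Trial

/-! ### The distribution of the outcome of a trial -/

section TrialDistribution

open Classical

variable {n : ℕ} (Q : QueryGraph n) (θ : ℝ) (g : Fin n → Fin n → ℝ≥0∞) (v : ℝ≥0∞)

theorem QueryGraph.deg_eq_card (u : Fin n) : Q.deg u = (Q.graph.neighborFinset u).card := by
  rw [QueryGraph.deg, Set.ncard_eq_toFinset_card']
  rfl

theorem QueryGraph.sum_nbr (u : Fin n) (φ : Fin n → ℝ≥0∞) :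
    ∑ j : Fin (Q.deg u), φ (Q.nbr u j) = ∑ w ∈ Q.graph.neighborFinset u, φ w := by
  rw [show ∑ j : Fin (Q.deg u), φ (Q.nbr u j) = ∑ w : Q.graph.neighborSet u, φ w from
    Fintype.sum_equiv (Q.nbr u) _ _ fun _ => rfl]
  exact (Finset.sum_subtype _ (fun w => by simp) φ).symm

/-- The number of neighbors that are not heavy. -/
def lightDeg (u : Fin n) : ℕ :=
  ((Q.graph.neighborFinset u).filter fun w => ¬θ < Q.deg w).card

/-- The probability that a trial returns a given edge in the orientation that starts at `u`. -/
def edgeWeight (u : Fin n) : ℝ≥0∞ :=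
  2⁻¹ * (n : ℝ≥0∞)⁻¹ * (⌊θ⌋₊ : ℝ≥0∞)⁻¹ *
    if θ < Q.deg u then (Q.deg u : ℝ≥0∞)⁻¹ * lightDeg Q θ u else 1

/-- The probability that a trial fails. -/
def failProb : ℝ≥0∞ := trialValue Q θ (fun _ _ => 0) 1

theorem secondValue_eq (w : Fin n) : secondValue Q θ g v w =
    secondValue Q θ g 0 w + secondValue Q θ (fun _ _ => 0) 1 w * v := by
  unfold secondValue
  split_ifs <;> simp

theorem choiceValue_eq (u : Fin n) (j : ℕ) : choiceValue Q θ g v u j =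
    choiceValue Q θ g 0 u j + choiceValue Q θ (fun _ _ => 0) 1 u j * v := by
  unfold choiceValue
  split_ifs
  · simp
  · rw [secondValue_eq]; ring
  · simp

/-- A trial is affine in the value of failure, which turns the sequence of trials into a linear
recursion. -/
theorem trialValue_eq : trialValue Q θ g v = trialValue Q θ g 0 + failProb Q θ * v := by
  unfold failProb trialValue
  simp only [choiceValue_eq Q θ g v, Finset.sum_add_distrib, mul_add, ← Finset.sum_mul,
    ← mul_assoc]

variable {θ} in
-- The probabilities of all outcomes of a trial sum to 1; `θ ≥ 1` makes both the range of `j` and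
-- the degree of a heavy vertex nonzero.
theorem trialValue_one (hn : 0 < n) (hθ : 1 ≤ θ) : trialValue Q θ (fun _ _ => 1) 1 = 1 := by
  have hs : ∀ w, secondValue Q θ (fun _ _ => 1) 1 w = 1 := by
    intro w
    unfold secondValue
    split_ifs with h
    · have : Q.deg w ≠ 0 := by
        rintro h0
        rw [h0, Nat.cast_zero] at h
        linarith
      simp [ENNReal.inv_mul_cancel, this]
    · rfl
  have hc : ∀ u j, choiceValue Q θ (fun _ _ => 1) 1 u j = 1 := by
    intro u j
    unfold choiceValue
    split_ifs
    · rfl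
    · rw [hs, one_add_one_eq_two, ENNReal.inv_mul_cancel (by simp) (by simp)]
    · rfl
  have hN : ⌊θ⌋₊ ≠ 0 := (Nat.floor_pos.2 hθ).ne'
  simp [trialValue, hc, ENNReal.inv_mul_cancel, hN, hn.ne']

/-- A light vertex has degree at most `⌊θ⌋₊`, so each of its neighbors is hit by exactly one `j`,
and the remaining `j` fail. -/
theorem sum_choiceValue (u : Fin n) : ∑ j : Fin ⌊θ⌋₊, choiceValue Q θ g 0 u j =
    if θ < Q.deg u then 0
    else ∑ w ∈ Q.graph.neighborFinset u, 2⁻¹ * (g u w + secondValue Q θ g 0 w) := by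
  by_cases hd : θ < Q.deg u
  · simp [choiceValue, hd]
  rw [if_neg hd, ← Q.sum_nbr u fun w => 2⁻¹ * (g u w + secondValue Q θ g 0 w)]
  have hle : Q.deg u ≤ ⌊θ⌋₊ := Nat.le_floor (not_lt.1 hd)
  rw [Fin.sum_univ_eq_sum_range (fun j => choiceValue Q θ g 0 u j),
    ← Finset.sum_subset (Finset.range_subset_range.2 hle),
    ← Fin.sum_univ_eq_sum_range (fun j => choiceValue Q θ g 0 u j)]
  · refine Finset.sum_congr rfl fun j _ => ?_
    rw [choiceValue, if_neg hd, dif_pos j.2]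
    rfl
  · intro j _ hj
    simp only [Finset.mem_range] at hj
    simp [choiceValue, hj]

/-- Double counting: summing over light `u` and then over neighbors `w` reaches each `w` exactly
`lightDeg` times. A heavy `w` spreads this mass evenly over its edges, while a light `w` only gets
its direct term, whence the two cases of `edgeWeight`. -/
theorem trialValue_zero : trialValue Q θ g 0 =
    ∑ u, edgeWeight Q θ u * ∑ w ∈ Q.graph.neighborFinset u, g u w := by
  have hswap : ∑ u, (if θ < Q.deg u then 0 else
      ∑ w ∈ Q.graph.neighborFinset u, secondValue Q θ g 0 w) =
      ∑ w, (lightDeg Q θ w : ℝ≥0∞) * secondValue Q θ g 0 w := by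
    calc _ = ∑ u ∈ Finset.univ.filter fun u => ¬θ < Q.deg u,
          ∑ w ∈ Q.graph.neighborFinset u, secondValue Q θ g 0 w := by
          rw [Finset.sum_filter]
          exact Finset.sum_congr rfl fun u _ => by split_ifs <;> rfl
      _ = ∑ w, ∑ u ∈ (Q.graph.neighborFinset w).filter fun u => ¬θ < Q.deg u,
          secondValue Q θ g 0 w := by
          refine Finset.sum_comm' fun u w => ?_
          simp [SimpleGraph.adj_comm, and_comm]
      _ = _ := by simp [lightDeg]
  have hsplit : ∀ u, (if θ < Q.deg u then (0 : ℝ≥0∞) else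
      ∑ w ∈ Q.graph.neighborFinset u, 2⁻¹ * (g u w + secondValue Q θ g 0 w)) =
      2⁻¹ * ((if θ < Q.deg u then 0 else ∑ w ∈ Q.graph.neighborFinset u, g u w) +
        if θ < Q.deg u then 0 else ∑ w ∈ Q.graph.neighborFinset u, secondValue Q θ g 0 w) := by
    intro u
    split_ifs
    · simp
    · rw [← Finset.mul_sum, Finset.sum_add_distrib]
  unfold trialValue
  simp only [sum_choiceValue, hsplit]
  simp only [← Finset.mul_sum]
  rw [Finset.sum_add_distrib, hswap, ← Finset.sum_add_distrib]
  simp only [Finset.mul_sum _ _ (2 : ℝ≥0∞)⁻¹, Finset.mul_sum _ _ (⌊θ⌋₊ : ℝ≥0∞)⁻¹,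
    Finset.mul_sum _ _ (n : ℝ≥0∞)⁻¹]
  refine Finset.sum_congr rfl fun u _ => ?_
  unfold edgeWeight secondValue
  split_ifs
  · rw [Q.sum_nbr u (g u)]
    ring
  · ring

theorem sum_edgeWeight_add_failProb (hn : 0 < n) (hθ : 1 ≤ θ) :
    ∑ u, edgeWeight Q θ u * Q.deg u + failProb Q θ = 1 := by
  have h := trialValue_one Q hn hθ
  rw [trialValue_eq, trialValue_zero, mul_one] at h
  simpa [← Q.deg_eq_card] using h

/-! ### Counting edges -/

theorem QueryGraph.sum_deg : ∑ u, Q.deg u = 2 * Q.numEdges := by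
  rw [QueryGraph.numEdges, Set.ncard_eq_toFinset_card']
  have := Q.graph.sum_degrees_eq_twice_card_edges
  simp only [← SimpleGraph.card_neighborFinset_eq_degree, ← Q.deg_eq_card] at this
  rw [this]
  rfl

theorem QueryGraph.two_mul_numEdges_le : 2 * Q.numEdges ≤ n ^ 2 := by
  rw [← Q.sum_deg, sq]
  calc ∑ u, Q.deg u ≤ ∑ _u : Fin n, n := Finset.sum_le_sum fun u _ => by
        rw [Q.deg_eq_card]
        exact (Finset.card_le_univ _).trans (by simp)
    _ = n * n := by simp

theorem QueryGraph.sum_indicator_edge {e : Sym2 (Fin n)} (he : e ∈ Q.graph.edgeSet) :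
    ∑ u, ∑ w ∈ Q.graph.neighborFinset u, (if s(u, w) = e then (1 : ℝ≥0∞) else 0) = 2 := by
  induction e using Sym2.ind with | _ a b
  rw [SimpleGraph.mem_edgeSet] at he
  have hab : a ≠ b := he.ne
  have h : ∀ u, ∑ w ∈ Q.graph.neighborFinset u, (if s(u, w) = s(a, b) then (1 : ℝ≥0∞) else 0) =
      (if u = a then 1 else 0) + if u = b then 1 else 0 := by
    intro u
    by_cases hua : u = a
    · subst hua
      simp [hab, Finset.sum_ite_eq', he]
    · by_cases hub : u = b
      · subst hub
        simp [hab.symm, Finset.sum_ite_eq', he.symm]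
      · simp [hua, hub]
  simp only [h, Finset.sum_add_distrib, Finset.sum_ite_eq', Finset.mem_univ, if_true]
  norm_num

/-- There are few heavy vertices. -/
theorem heavy_card_le (hθ : 0 < θ) (hm : 40 * (Q.numEdges : ℝ) ≤ θ ^ 2) :
    ((Finset.univ.filter fun u => θ < Q.deg u).card : ℝ) ≤ θ / 20 := by
  have h : ((Finset.univ.filter fun u => θ < Q.deg u).card : ℝ) * θ ≤ 2 * Q.numEdges := by
    have h1 : (2 * Q.numEdges : ℝ) = ∑ u, (Q.deg u : ℝ) := by exact_mod_cast Q.sum_deg.symm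
    rw [h1, ← nsmul_eq_mul, ← Finset.sum_const]
    refine (Finset.sum_le_sum fun u hu => ?_).trans
      (Finset.sum_le_sum_of_subset_of_nonneg (Finset.filter_subset _ _) fun _ _ _ => by positivity)
    exact (Finset.mem_filter.1 hu).2.le
  have h2 : ((Finset.univ.filter fun u => θ < Q.deg u).card : ℝ) * θ ≤ θ / 20 * θ := by nlinarith
  exact le_of_mul_le_mul_right h2 hθ

theorem lightDeg_le (u : Fin n) : lightDeg Q θ u ≤ Q.deg u := by
  rw [Q.deg_eq_card]
  exact Finset.card_filter_le _ _

/-- The heavy neighbors of `u` are among the at most `θ / 20` heavy vertices, which is less than a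
twentieth of the degree of `u`. -/
theorem le_lightDeg (hθ : 0 < θ) (hm : 40 * (Q.numEdges : ℝ) ≤ θ ^ 2) {u : Fin n}
    (hu : θ < Q.deg u) : 19 / 20 * (Q.deg u : ℝ) ≤ lightDeg Q θ u := by
  have h1 : Q.deg u = ((Q.graph.neighborFinset u).filter fun w => θ < Q.deg w).card +
      lightDeg Q θ u := by
    rw [Q.deg_eq_card]
    exact (Finset.card_filter_add_card_filter_not _).symm
  have h2 : ((Q.graph.neighborFinset u).filter fun w => θ < Q.deg w).card ≤
      (Finset.univ.filter fun u => θ < Q.deg u).card :=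
    Finset.card_le_card (Finset.filter_subset_filter _ (Finset.subset_univ _))
  have h3 := heavy_card_le Q θ hθ hm
  have h1' : (Q.deg u : ℝ) = (((Q.graph.neighborFinset u).filter fun w => θ < Q.deg w).card : ℝ) +
    lightDeg Q θ u := by exact_mod_cast h1
  have h2' : (((Q.graph.neighborFinset u).filter fun w => θ < Q.deg w).card : ℝ) ≤
    ((Finset.univ.filter fun u => θ < Q.deg u).card : ℝ) := by exact_mod_cast h2
  linarith

/-! ### Near-uniformity of a trial -/

/-- The weight of an edge at a vertex that is not heavy. -/
def unitWeight (n : ℕ) (θ : ℝ) : ℝ≥0∞ := 2⁻¹ * (n : ℝ≥0∞)⁻¹ * (⌊θ⌋₊ : ℝ≥0∞)⁻¹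

theorem edgeWeight_le (u : Fin n) : edgeWeight Q θ u ≤ unitWeight n θ := by
  unfold edgeWeight unitWeight
  refine mul_le_of_le_one_right (zero_le) ?_
  split_ifs
  · rw [mul_comm, ← div_eq_mul_inv]
    exact ENNReal.div_le_of_le_mul (by simpa using lightDeg_le Q θ u)
  · rfl

theorem le_edgeWeight (hθ : 0 < θ) (hm : 40 * (Q.numEdges : ℝ) ≤ θ ^ 2) (u : Fin n) :
    unitWeight n θ * ENNReal.ofReal (19 / 20) ≤ edgeWeight Q θ u := by
  unfold edgeWeight unitWeight
  gcongr
  split_ifs with h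
  · have hd : (0 : ℝ) < Q.deg u := hθ.trans h
    have := le_lightDeg Q θ hθ hm h
    rw [← ENNReal.ofReal_natCast, ← ENNReal.ofReal_natCast, ← ENNReal.ofReal_inv_of_pos hd,
      ← ENNReal.ofReal_mul (by positivity)]
    refine ENNReal.ofReal_le_ofReal ?_
    rw [inv_mul_eq_div, le_div_iff₀ hd]
    exact this
  · rw [ENNReal.ofReal_le_one]; norm_num

/-- The probability that a trial returns the edge `e`. -/
def edgeProb (e : Sym2 (Fin n)) : ℝ≥0∞ :=
  ∑ u, edgeWeight Q θ u * ∑ w ∈ Q.graph.neighborFinset u, if s(u, w) = e then 1 else 0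

/-- The probability that a trial returns an edge. -/
def successProb : ℝ≥0∞ := ∑ u, edgeWeight Q θ u * Q.deg u

theorem edgeProb_le {e : Sym2 (Fin n)} (he : e ∈ Q.graph.edgeSet) :
    edgeProb Q θ e ≤ unitWeight n θ * 2 := by
  rw [← Q.sum_indicator_edge he, Finset.mul_sum]
  exact Finset.sum_le_sum fun u _ => by gcongr; exact edgeWeight_le Q θ u

theorem le_edgeProb (hθ : 0 < θ) (hm : 40 * (Q.numEdges : ℝ) ≤ θ ^ 2) {e : Sym2 (Fin n)}
    (he : e ∈ Q.graph.edgeSet) :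
    unitWeight n θ * ENNReal.ofReal (19 / 20) * 2 ≤ edgeProb Q θ e := by
  rw [← Q.sum_indicator_edge he, Finset.mul_sum]
  exact Finset.sum_le_sum fun u _ => by gcongr; exact le_edgeWeight Q θ hθ hm u

theorem QueryGraph.sum_deg_ennreal : ∑ u, (Q.deg u : ℝ≥0∞) = 2 * Q.numEdges := by
  exact_mod_cast Q.sum_deg

theorem successProb_le : successProb Q θ ≤ unitWeight n θ * (2 * Q.numEdges) := by
  rw [← Q.sum_deg_ennreal, Finset.mul_sum]
  exact Finset.sum_le_sum fun u _ => by gcongr; exact edgeWeight_le Q θ u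

theorem le_successProb (hθ : 0 < θ) (hm : 40 * (Q.numEdges : ℝ) ≤ θ ^ 2) :
    unitWeight n θ * ENNReal.ofReal (19 / 20) * (2 * Q.numEdges) ≤ successProb Q θ := by
  rw [← Q.sum_deg_ennreal, Finset.mul_sum]
  exact Finset.sum_le_sum fun u _ => by gcongr; exact le_edgeWeight Q θ hθ hm u

end TrialDistribution

/-! ### An almost uniform edge sampler

The sampler makes up to `A = 160 n L` trials, where `L = ⌈log₂ (20 n² / δ)⌉`, and stops at the first
success. The threshold of trial number `k` is `A / k`. -/

/-- The sampling procedure. -/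
def edgeSampler : Prog ℕ :=
  .block [
    .op (.const 5 1),
    .op (.const 3 0),
    .op (.const 8 20),
    .op (.mul 8 8 0),
    .op (.mul 8 8 0),
    .op (.copy 6 2),
    .op (.const 7 0),
    .loop 6 8 (.block [
      .op (.add 6 6 6),
      .op (.add 7 7 5)]),
    .op (.const 9 160),
    .op (.mul 9 9 0),
    .op (.mul 9 9 7),
    .op (.const 10 0),
    .loop 10 9 samplerTrial]

/-- The trials. -/
def samplerLoop : Prog ℕ := .loop 10 9 samplerTrial

/-- One turn of the loop that computes the number of trials. -/
def samplerLenNext (σ : Store ℕ) : Store ℕ :=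
  Function.update (Function.update σ 6 (σ 6 + σ 6)) 7 (σ 7 + σ 5)

theorem samplerLenNext_iterate (σ : Store ℕ) (h5 : σ 5 = 1) (h7 : σ 7 = 0) (j : ℕ) :
    samplerLenNext^[j] σ = Function.update (Function.update σ 6 (σ 6 * 2 ^ j)) 7 j := by
  induction j with
  | zero => simp [← h7]
  | succ j ih =>
    rw [Function.iterate_succ_apply', ih]
    ext z
    simp only [samplerLenNext, Function.update_apply]
    split_ifs <;> simp_all
    ring

theorem edgeSampler_setup {n : ℕ} (Q : QueryGraph n) {η δ : ℝ} {σ : Store ℕ} (hn : 0 < n)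
    (hδ : 0 < δ) (hδ1 : δ < 1) (hσ : SamplerInput n η δ σ) :
    ∃ (L T : ℕ) (σ' : Store ℕ), 1 ≤ L ∧ 20 * (n : ℝ) ^ 2 ≤ δ * 2 ^ L ∧
      δ * 2 ^ L < 40 * (n : ℝ) ^ 2 ∧ T ≤ 30 + 6 * L ∧
      SamplerState n ((160 * n * L : ℕ) : ℝ) 0 σ' ∧
      ∀ τ f, runCost Q τ f [edgeSampler] σ =
        T * τ + runCost Q τ f [samplerLoop, .block []] σ' := by
  have hn1 : (1 : ℝ) ≤ n := by exact_mod_cast hn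
  -- The target `20n²` makes `2 ^ (-L)` at most `δ / (20n²)`, small against both `δ` and `1 / m`.
  obtain ⟨L, hL, hL1, hL2, hlt⟩ := exists_doubling hδ (show δ < 20 * (n : ℝ) ^ 2 by nlinarith)
  obtain ⟨h0, -, h2⟩ := hσ
  set σ₁ : Store ℕ := Function.update (Function.update (Function.update (Function.update
    (Function.update σ 5 1) 3 0) 8 (20 * (n : ℝ) ^ 2)) 6 δ) 7 0 with h₁
  set σ₂ := Function.update (Function.update σ₁ 6 (δ * 2 ^ L)) 7 L with h₂
  set σ₃ : Store ℕ := Function.update (Function.update σ₂ 9 ((160 * n * L : ℕ) : ℝ)) 10 0 with h₃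
  have hit : ∀ j, samplerLenNext^[j] σ₁ = Function.update (Function.update σ₁ 6 (δ * 2 ^ j)) 7 j :=
    fun j => by
      rw [samplerLenNext_iterate σ₁ (by simp [h₁]) (by simp [h₁])]
      simp [h₁]
  have hbody : ∀ τ f K σ, runCost Q τ f (Prog.block [.op (.add 6 6 6), .op (.add 7 7 5)] :: K) σ =
      (5 : ℕ) * τ + runCost Q τ f K (samplerLenNext σ) := by
    intro τ f K σ
    simp only [runCost_block_cons, runCost_block_nil, runCost_addInstr, samplerLenNext]
    simp [Function.update_of_ne]
    ring
  refine ⟨L, 25 + 6 * L, σ₃, hL, hL1, by linarith, by omega, ?_, fun τ f => ?_⟩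
  · constructor <;> simp [h₃, h₂, h₁, h0]
  · simp only [edgeSampler, runCost_block_cons, runCost_const, runCost_copy, runCost_mul]
    rw [show Function.update (Function.update (Function.update (Function.update (Function.update
      (Function.update (Function.update σ 5 ((1 : ℚ) : ℝ)) 3 ((0 : ℚ) : ℝ)) 8 _) 8 _) 8 _) 6 _) 7
      ((0 : ℚ) : ℝ) = σ₁ by simp [h₁, h0, h2, sq, mul_assoc]]
    rw [runCost_loop_iterate Q hbody τ f _ L σ₁
      (fun j hj => by rw [hit]; simpa [h₁] using hlt j hj) (by rw [hit]; simpa [h₁] using hL1),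
      hit, ← h₂]
    simp only [runCost_block_cons, runCost_const, runCost_mul]
    rw [show Function.update (Function.update (Function.update (Function.update σ₂ 9 _) 9 _) 9 _) 10
      ((0 : ℚ) : ℝ) = σ₃ by simp [h₃, h₂, h₁, h0]]
    push_cast
    simp only [← add_assoc]
    congr 1
    ring

theorem SamplerDone.loop_eq {n : ℕ} {Q : QueryGraph n} {A : ℝ} {a b : Fin n} {σ : Store ℕ}
    (h : SamplerDone A a b σ) (τ : ℝ≥0∞) (f : Store ℕ → ℝ≥0∞) :
    runCost Q τ f [samplerLoop, .block []] σ = 2 * τ + f σ := by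
  rw [samplerLoop, runCost_loop_neg _ _ _ _ _ (by simp [h.total, h.trials]), runCost_block_nil,
    runCost_nil]
  ring

theorem SamplerState.loop_end {n : ℕ} {Q : QueryGraph n} {A : ℕ} {σ : Store ℕ}
    (h : SamplerState n A A σ) (τ : ℝ≥0∞) (f : Store ℕ → ℝ≥0∞) :
    runCost Q τ f [samplerLoop, .block []] σ = 2 * τ + f σ := by
  rw [samplerLoop, runCost_loop_neg _ _ _ _ _ (by simp [h.total, h.trials]), runCost_block_nil,
    runCost_nil]
  ring

theorem one_le_threshold {A k : ℕ} (h : k < A) : 1 ≤ (A : ℝ) / (k + 1) := by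
  rw [one_le_div (by positivity)]
  exact_mod_cast h

/-- The value after `k` trials depends on the value after `k + 1`, so it is defined by recursion on
the number `A - k` of trials left. -/
theorem exists_backward_recursion {β : Type*} (A : ℕ) (v : β) (φ : ℕ → β → β) :
    ∃ W : ℕ → β, W A = v ∧ ∀ k < A, W k = φ k (W (k + 1)) := by
  let V : ℕ → β := fun j => Nat.rec v (fun j x => φ (A - (j + 1)) x) j
  refine ⟨fun k => V (A - k), by simp [V], fun k hk => ?_⟩
  obtain ⟨j, rfl⟩ : ∃ j, A = k + (j + 1) := ⟨A - k - 1, by omega⟩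
  simp only
  rw [show k + (j + 1) - k = j + 1 by omega, show k + (j + 1) - (k + 1) = j by omega]
  simp only [V]
  rw [show k + (j + 1) - (j + 1) = k by omega]

/-- The value of the trials that follow trial number `k` satisfies the obvious recursion. -/
theorem samplerLoop_value {n : ℕ} (Q : QueryGraph n) (hn : 0 < n) (A : ℕ)
    (g : Fin n → Fin n → ℝ≥0∞) (v : ℝ≥0∞) {f : Store ℕ → ℝ≥0∞}
    (hv : ∀ σ, SamplerState n A A σ → f σ = v)
    (hg : ∀ a b σ, SamplerDone (A : ℝ) a b σ → f σ = g a b) :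
    ∃ W : ℕ → ℝ≥0∞, W A = v ∧ (∀ k < A, W k = trialValue Q (A / (k + 1)) g (W (k + 1))) ∧
      ∀ k ≤ A, ∀ σ, SamplerState n A k σ →
        runCost Q 0 f [samplerLoop, .block []] σ = W k := by
  obtain ⟨W, hWA, hW⟩ := exists_backward_recursion A v fun k => trialValue Q (A / (k + 1)) g
  refine ⟨W, hWA, hW, fun k hk => ?_⟩
  induction hk using Nat.decreasingInduction with
  | self =>
    intro σ hσ
    rw [hσ.loop_end, mul_zero, zero_add, hv σ hσ, hWA]
  | of_succ k hk ih =>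
    intro σ hσ
    rw [hW k hk, samplerLoop, runCost_loop_pos _ _ _ _ _ (by
      rw [hσ.total, hσ.trials]; exact_mod_cast hk), ← samplerLoop, zero_add]
    refine runCost_samplerTrial Q g _ (fun σ' hσ' => ih σ' hσ') (fun a b σ' hσ' => ?_) hσ hn
      (one_le_threshold hk)
    rw [hσ'.loop_eq, mul_zero, zero_add, hg a b σ' hσ']

theorem samplerTrial_time {n : ℕ} (Q : QueryGraph n) (σ : Store ℕ) :
    runCost Q 1 (fun _ => 0) [samplerTrial] σ ≤ 60 := by
  have h : samplerTrial.LoopFree := by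
    simp [samplerTrial, samplerFound, Prog.LoopFree, Prog.block]
  refine (h.time_le Q σ).trans ?_
  have : samplerTrial.size ≤ 60 := by
    simp [samplerTrial, samplerFound, Prog.size, Prog.block]
  exact_mod_cast this

/-- Per turn, 63 is one step for the test, 60 for a trial and 2 for leaving the loop after a
success; `W k` bounds the time still to be spent after `k` failures. -/
theorem samplerLoop_time {n : ℕ} (Q : QueryGraph n) (hn : 0 < n) (A : ℕ) :
    ∃ W : ℕ → ℝ≥0∞, W A = 2 ∧ (∀ k < A, W k = 63 + failProb Q (A / (k + 1)) * W (k + 1)) ∧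
      ∀ k ≤ A, ∀ σ, SamplerState n A k σ →
        runCost Q 1 (fun _ => 0) [samplerLoop, .block []] σ ≤ W k := by
  classical
  obtain ⟨W, hWA, hW⟩ := exists_backward_recursion A (2 : ℝ≥0∞)
    fun k x => 63 + failProb Q (A / (k + 1)) * x
  refine ⟨W, hWA, hW, fun k hk => ?_⟩
  induction hk using Nat.decreasingInduction with
  | self =>
    intro σ hσ
    rw [hσ.loop_end, hWA]
    simp
  | of_succ k hk ih =>
    intro σ hσ
    rw [hW k hk, samplerLoop, runCost_loop_pos _ _ _ _ _ (by
      rw [hσ.total, hσ.trials]; exact_mod_cast hk), ← samplerLoop, runCost_cons_eq,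
      runCost_eq_time_add]
    -- The value `⊤` on all other stores makes the pointwise bound `hF` trivial there; it is
    -- harmless because a trial only ends in stores of the first two kinds.
    let F : Store ℕ → ℝ≥0∞ := fun σ =>
      if SamplerState n A (k + 1) σ then W (k + 1)
      else if ∃ a b : Fin n, SamplerDone (A : ℝ) a b σ then 2 else ⊤
    have hF : ∀ σ', runCost Q 1 (fun _ => 0) [samplerLoop, .block []] σ' ≤ F σ' := by
      intro σ'
      simp only [F]
      split_ifs with h1 h2
      · exact ih σ' h1
      · obtain ⟨a, b, h⟩ := h2
        rw [h.loop_eq]; simp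
      · exact le_top
    have hval : runCost Q 0 F [samplerTrial] σ = trialValue Q (A / (k + 1)) (fun _ _ => 2)
        (W (k + 1)) := by
      refine runCost_samplerTrial Q _ _ (fun σ' hσ' => ?_) (fun a b σ' hσ' => ?_) hσ hn
        (one_le_threshold hk)
      · rw [runCost_nil]
        simp [F, hσ']
      · rw [runCost_nil]
        have hno : ¬SamplerState n (A : ℝ) (k + 1) σ' := by
          intro h
          have := one_le_vertexLabel a
          rw [← hσ'.fst, h.result] at this
          linarith
        have hex : ∃ a b : Fin n, SamplerDone (A : ℝ) a b σ' := ⟨a, b, hσ'⟩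
        simp only [F]
        rw [if_neg hno, if_pos hex]
    have hle : trialValue Q (A / (k + 1)) (fun _ _ => 2) 0 ≤ 2 := by
      have h1 := sum_edgeWeight_add_failProb Q _ hn (one_le_threshold hk)
      rw [trialValue_zero]
      calc ∑ u, edgeWeight Q (A / (k + 1)) u * ∑ w ∈ Q.graph.neighborFinset u, (2 : ℝ≥0∞)
          = (∑ u, edgeWeight Q (A / (k + 1)) u * Q.deg u) * 2 := by
            rw [Finset.sum_mul]
            refine Finset.sum_congr rfl fun u _ => ?_
            rw [Finset.sum_const, nsmul_eq_mul, ← Q.deg_eq_card, mul_assoc]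
        _ ≤ 1 * 2 := by gcongr; rw [← h1]; exact le_self_add
        _ = 2 := one_mul _
    calc 1 + (runCost Q 1 (fun _ => 0) [samplerTrial] σ + runCost Q 0
          (runCost Q 1 (fun _ => 0) [samplerLoop, .block []]) [samplerTrial] σ)
        ≤ 1 + (60 + trialValue Q (A / (k + 1)) (fun _ _ => 2) (W (k + 1))) := by
          gcongr
          · exact samplerTrial_time Q σ
          · rw [← hval]; exact runCost_mono Q 0 hF _ _
      _ ≤ 1 + (60 + (2 + failProb Q (A / (k + 1)) * W (k + 1))) := by
          rw [trialValue_eq]; gcongr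
      _ = _ := by ring

/-! ### Recursions -/

/-- If in each of the first `t` trials the wanted outcome has at least the share `κ` of the success
probability, it has at least that share of the probability that one of these trials succeeds. -/
theorem le_add_of_recursion {κ : ℝ≥0∞} (t : ℕ) (W q p c : ℕ → ℝ≥0∞)
    (hW : ∀ k < t, W k = q k + c k * W (k + 1)) (hp : ∀ k < t, p k + c k = 1)
    (hq : ∀ k < t, κ * p k ≤ q k) : κ ≤ W 0 + κ * ∏ k ∈ Finset.range t, c k := by
  induction t generalizing W q p c with
  | zero => simp
  | succ t ih =>
    have h := ih (fun k => W (k + 1)) (fun k => q (k + 1)) (fun k => p (k + 1)) (fun k => c (k + 1))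
      (fun k hk => hW (k + 1) (by omega)) (fun k hk => hp (k + 1) (by omega))
      (fun k hk => hq (k + 1) (by omega))
    rw [Finset.prod_range_succ', hW 0 (by omega)]
    calc κ = κ * p 0 + c 0 * κ := by rw [mul_comm (c 0), ← mul_add, hp 0 (by omega), mul_one]
      _ ≤ q 0 + c 0 * (W 1 + κ * ∏ k ∈ Finset.range t, c (k + 1)) := by
        gcongr
        exact hq 0 (by omega)
      _ = _ := by ring

/-- The upper counterpart: a share of at most `κ` in the first `t` trials, plus whatever happens if
all of them fail. -/
theorem recursion_le {κ : ℝ≥0∞} (t : ℕ) (W q p c : ℕ → ℝ≥0∞)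
    (hW : ∀ k < t, W k = q k + c k * W (k + 1)) (hp : ∀ k < t, p k + c k = 1)
    (hq : ∀ k < t, q k ≤ κ * p k) : W 0 ≤ κ + (∏ k ∈ Finset.range t, c k) * W t := by
  induction t generalizing W q p c with
  | zero => simp
  | succ t ih =>
    have h := ih (fun k => W (k + 1)) (fun k => q (k + 1)) (fun k => p (k + 1)) (fun k => c (k + 1))
      (fun k hk => hW (k + 1) (by omega)) (fun k hk => hp (k + 1) (by omega))
      (fun k hk => hq (k + 1) (by omega))
    rw [Finset.prod_range_succ', hW 0 (by omega)]
    calc q 0 + c 0 * W 1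
        ≤ κ * p 0 + c 0 * (κ + (∏ k ∈ Finset.range t, c (k + 1)) * W (t + 1)) := by
          gcongr
          exact hq 0 (by omega)
      _ = κ * (p 0 + c 0) + (∏ k ∈ Finset.range t, c (k + 1)) * c 0 * W (t + 1) := by ring
      _ = _ := by rw [hp 0 (by omega), mul_one]

theorem time_recursion_le {B : ℝ≥0∞} (t : ℕ) (W c : ℕ → ℝ≥0∞)
    (hW : ∀ k < t, W k ≤ B + c k * W (k + 1)) (hc : ∀ k < t, c k ≤ 1) :
    W 0 ≤ t * B + (∏ k ∈ Finset.range t, c k) * W t := by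
  induction t generalizing W c with
  | zero => simp
  | succ t ih =>
    have h := ih (fun k => W (k + 1)) (fun k => c (k + 1))
      (fun k hk => hW (k + 1) (by omega)) (fun k hk => hc (k + 1) (by omega))
    rw [Finset.prod_range_succ']
    calc W 0 ≤ B + c 0 * W 1 := hW 0 (by omega)
      _ ≤ B + c 0 * (t * B + (∏ k ∈ Finset.range t, c (k + 1)) * W (t + 1)) := by gcongr
      _ = B + c 0 * (t * B) + (∏ k ∈ Finset.range t, c (k + 1)) * c 0 * W (t + 1) := by ring
      _ ≤ B + 1 * (t * B) + (∏ k ∈ Finset.range t, c (k + 1)) * c 0 * W (t + 1) := by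
        gcongr
        exact hc 0 (by omega)
      _ = _ := by push_cast; ring

/-! ### The probability that the first trials fail -/

/-- The number of trials in which the threshold is large enough for the edges to be almost equally
likely. -/
def goodTrials (A m : ℕ) : ℕ := ⌊(A : ℝ) / √(40 * m)⌋₊

theorem one_le_sqrt_forty_mul {m : ℕ} (hm : 0 < m) : 1 ≤ √(40 * (m : ℝ)) := by
  rw [Real.one_le_sqrt]
  have : (1 : ℝ) ≤ m := by exact_mod_cast hm
  linarith

theorem goodTrials_le {A m : ℕ} (hm : 0 < m) : goodTrials A m ≤ A := by
  refine Nat.floor_le_of_le ?_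
  exact div_le_self (Nat.cast_nonneg A) (one_le_sqrt_forty_mul hm)

/-- A good trial has `k + 1 ≤ A / √(40m)`, so its threshold `A / (k + 1)` is at least `√(40m)`. -/
theorem le_threshold_sq {A m k : ℕ} (hm : 0 < m) (hk : k < goodTrials A m) :
    40 * (m : ℝ) ≤ ((A : ℝ) / (k + 1)) ^ 2 := by
  have hs := one_le_sqrt_forty_mul hm
  have h1 : ((k + 1 : ℕ) : ℝ) ≤ (A : ℝ) / √(40 * m) := (Nat.le_floor_iff (by positivity)).1 hk
  have h2 : √(40 * m) ≤ (A : ℝ) / (k + 1) := by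
    rw [le_div_iff₀ (by positivity)] at h1 ⊢
    push_cast at h1
    linarith
  calc 40 * (m : ℝ) = √(40 * m) ^ 2 := (Real.sq_sqrt (by positivity)).symm
    _ ≤ _ := by gcongr

theorem sum_range_succ_cast (t : ℕ) : ∑ k ∈ Finset.range t, ((k : ℝ) + 1) = t * (t + 1) / 2 := by
  induction t with
  | zero => simp
  | succ t ih => rw [Finset.sum_range_succ, ih]; push_cast; ring

section Failure

variable {n : ℕ} (Q : QueryGraph n)

theorem ofReal_le_successProb (hn : 0 < n) {θ : ℝ} (hθ : 1 ≤ θ)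
    (hm : 40 * (Q.numEdges : ℝ) ≤ θ ^ 2) :
    ENNReal.ofReal (19 / 20 * Q.numEdges / (n * θ)) ≤ successProb Q θ := by
  refine le_trans ?_ (le_successProb Q θ (by linarith) hm)
  have hn' : (0 : ℝ) < n := by exact_mod_cast hn
  have hN : (0 : ℝ) < ⌊θ⌋₊ := by exact_mod_cast Nat.floor_pos.2 hθ
  have hfl : (⌊θ⌋₊ : ℝ) ≤ θ := Nat.floor_le (by linarith)
  have h : unitWeight n θ * ENNReal.ofReal (19 / 20) * (2 * Q.numEdges) =
      ENNReal.ofReal (2⁻¹ * (n : ℝ)⁻¹ * (⌊θ⌋₊ : ℝ)⁻¹ * (19 / 20) * (2 * Q.numEdges)) := by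
    rw [ENNReal.ofReal_mul (by positivity), ENNReal.ofReal_mul (by positivity),
      ENNReal.ofReal_mul (by positivity), ENNReal.ofReal_mul (by positivity),
      ENNReal.ofReal_mul (by positivity), ENNReal.ofReal_inv_of_pos (by positivity),
      ENNReal.ofReal_inv_of_pos (by positivity), ENNReal.ofReal_inv_of_pos (by positivity),
      ENNReal.ofReal_natCast, ENNReal.ofReal_natCast, ENNReal.ofReal_natCast]
    simp [unitWeight]
  rw [h]
  refine ENNReal.ofReal_le_ofReal ?_
  have h2 : 2⁻¹ * (n : ℝ)⁻¹ * (⌊θ⌋₊ : ℝ)⁻¹ * (19 / 20) * (2 * Q.numEdges) =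
      19 / 20 * Q.numEdges / (n * ⌊θ⌋₊) := by
    field_simp
  rw [h2]
  gcongr

theorem failProb_le_exp (hn : 0 < n) {θ : ℝ} (hθ : 1 ≤ θ) (hm : 40 * (Q.numEdges : ℝ) ≤ θ ^ 2) :
    failProb Q θ ≤ ENNReal.ofReal (Real.exp (-(19 / 20 * Q.numEdges / (n * θ)))) := by
  have h1 := sum_edgeWeight_add_failProb Q θ hn hθ
  have h2 := ofReal_le_successProb Q hn hθ hm
  set x := 19 / 20 * (Q.numEdges : ℝ) / (n * θ)
  have hx : 0 ≤ x := by positivity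
  have h3 : ENNReal.ofReal x + failProb Q θ ≤ 1 := by
    rw [← h1]; exact add_le_add h2 le_rfl
  calc failProb Q θ ≤ 1 - ENNReal.ofReal x :=
        ENNReal.le_sub_of_add_le_left ENNReal.ofReal_ne_top h3
    _ = ENNReal.ofReal (1 - x) := by rw [ENNReal.ofReal_sub _ hx, ENNReal.ofReal_one]
    _ ≤ _ := ENNReal.ofReal_le_ofReal (by linarith [Real.add_one_le_exp (-x)])

theorem failProb_le_one (hn : 0 < n) {θ : ℝ} (hθ : 1 ≤ θ) : failProb Q θ ≤ 1 := by
  rw [← sum_edgeWeight_add_failProb Q θ hn hθ]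
  exact le_add_self

/-- Good trial number `k` succeeds with probability at least `0.95 * m * k / (nA)`. Summed up to
`t`, about `A / √(40m)`, this gives at least `0.95 * A / (160n) = 0.95 * L`; the constant 160 in `A`
is chosen for this. -/
theorem prod_failProb_le (hn : 0 < n) (hm : 0 < Q.numEdges) {L : ℕ} (hL : 1 ≤ L) {δ : ℝ}
    (hLδ : 20 * (n : ℝ) ^ 2 ≤ δ * 2 ^ L) :
    ∏ k ∈ Finset.range (goodTrials (160 * n * L) Q.numEdges),
      failProb Q (((160 * n * L : ℕ) : ℝ) / (k + 1)) ≤ ENNReal.ofReal (δ / (20 * n ^ 2)) := by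
  set A := 160 * n * L with hA
  set m := Q.numEdges with hm'
  set t := goodTrials A m with ht
  have hn1 : (1 : ℝ) ≤ n := by exact_mod_cast hn
  have hL1 : (1 : ℝ) ≤ L := by exact_mod_cast hL
  have hm1 : (1 : ℝ) ≤ m := by exact_mod_cast hm
  have hAr : (A : ℝ) = 160 * n * L := by rw [hA]; push_cast; ring
  have hApos : (0 : ℝ) < A := by rw [hAr]; positivity
  have hmn : 2 * (m : ℝ) ≤ (n : ℝ) ^ 2 := by exact_mod_cast Q.two_mul_numEdges_le
  have hs := one_le_sqrt_forty_mul hm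
  have hsq : √(40 * (m : ℝ)) ^ 2 = 40 * m := Real.sq_sqrt (by positivity)
  set y := (A : ℝ) / √(40 * m) with hy
  have hy2 : y ^ 2 = A ^ 2 / (40 * m) := by rw [hy, div_pow, hsq]
  have hy1 : 1 ≤ y := by
    rw [hy, one_le_div (by linarith)]
    refine Real.sqrt_le_iff.2 ⟨hApos.le, ?_⟩
    rw [hAr]
    have : (n : ℝ) ≤ n * L := le_mul_of_one_le_right (by linarith) hL1
    nlinarith
  have ht1 : (t : ℝ) ≤ y := Nat.floor_le (by positivity)
  have ht2 : y < t + 1 := Nat.lt_floor_add_one y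
  have ht3 : (1 : ℝ) ≤ t := by exact_mod_cast (Nat.le_floor (by simpa using hy1) : 1 ≤ ⌊y⌋₊)
  -- The left side is `y² / 4`, and `y < t + 1 ≤ 2t`; rounding down costs a factor of at most 2
  -- because `t ≥ 1`.
  have hkey : (A : ℝ) ^ 2 / (160 * m) ≤ t * (t + 1) / 2 := by
    have : (A : ℝ) ^ 2 / (160 * m) = y ^ 2 / 4 := by rw [hy2]; field_simp; norm_num
    rw [this]
    nlinarith
  calc ∏ k ∈ Finset.range t, failProb Q ((A : ℝ) / (k + 1))
      ≤ ∏ k ∈ Finset.range t, ENNReal.ofReal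
          (Real.exp (-(19 / 20 * m / (n * A) * ((k : ℝ) + 1)))) := by
        refine Finset.prod_le_prod' fun k hk => ?_
        have hkt := Finset.mem_range.1 hk
        refine (failProb_le_exp Q hn (one_le_threshold (hkt.trans_le (goodTrials_le hm)))
          (le_threshold_sq hm hkt)).trans (le_of_eq ?_)
        congr 3
        field_simp
        rw [hm']
    _ = ENNReal.ofReal (Real.exp (-(19 / 20 * m / (n * A) * (t * (t + 1) / 2)))) := by
        rw [← ENNReal.ofReal_prod_of_nonneg fun k _ => (Real.exp_pos _).le, ← Real.exp_sum,
          Finset.sum_neg_distrib, ← Finset.mul_sum, sum_range_succ_cast]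
    _ ≤ ENNReal.ofReal (δ / (20 * n ^ 2)) := by
        refine ENNReal.ofReal_le_ofReal ?_
        have h1 : 19 / 20 * (L : ℝ) ≤ 19 / 20 * m / (n * A) * (t * (t + 1) / 2) := by
          calc 19 / 20 * (L : ℝ) = 19 / 20 * m / (n * A) * (A ^ 2 / (160 * m)) := by
                rw [hAr]; field_simp
            _ ≤ _ := by gcongr
        have h2 : Real.exp (-(19 / 20 * m / (n * A) * (t * (t + 1) / 2))) ≤ (2 ^ L : ℝ)⁻¹ := by
          rw [← Real.exp_log (show (0 : ℝ) < (2 ^ L)⁻¹ by positivity), Real.exp_le_exp,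
            Real.log_inv, Real.log_pow]
          -- `19/20` exceeds `log 2`, so `exp (-0.95 * L) ≤ 2 ^ (-L)`.
          have := Real.log_two_lt_d9
          nlinarith
        refine h2.trans ?_
        rw [inv_le_iff_one_le_mul₀ (by positivity), div_mul_eq_mul_div, le_div_iff₀ (by positivity)]
        linarith

end Failure

/-! ### Correctness of the sampler -/

/-- In a good trial each edge has a share of the success probability between `19/20 / m` and `20/19
/ m`. The good trials all fail with probability at most `δ / (20n²) ≤ 1/40 / m`, so later trials,
about whose bias nothing is known, disturb the result only slightly: `19/20 - 1/20 = 0.9` and `20/19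
+ 1/40 < 1.1`. -/
theorem edgeSampler_correct : SamplesAlmostUniformly edgeSampler (1 / 10) := by
  classical
  intro n Q δ σ hm hδ hδ1 hσ
  have hmn : 2 * (Q.numEdges : ℝ) ≤ (n : ℝ) ^ 2 := by exact_mod_cast Q.two_mul_numEdges_le
  have hn : 0 < n := by
    rcases Nat.eq_zero_or_pos n with rfl | h
    · have := Q.two_mul_numEdges_le
      omega
    · exact h
  have hn1 : (1 : ℝ) ≤ n := by exact_mod_cast hn
  have hm1 : (1 : ℝ) ≤ Q.numEdges := by exact_mod_cast hm
  obtain ⟨L, T, σ', hL, hLδ, -, -, hσ', heq⟩ := edgeSampler_setup Q hn hδ hδ1 hσ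
  simp only [haltProb_eq_runCost, heq, mul_zero, zero_add]
  have hprod := prod_failProb_le Q hn hm hL hLδ
  set A := 160 * n * L
  set t := goodTrials A Q.numEdges with ht
  have htA : t ≤ A := goodTrials_le hm
  have hdone : ∀ {a b : Fin n} {σ : Store ℕ}, SamplerDone (A : ℝ) a b σ → ∀ e : Sym2 (Fin n),
      σ ∈ returnsEdge e ↔ s(a, b) = e := by
    intro a b σ h e
    refine ⟨fun h' => returnsEdge_unique ⟨a, b, rfl, h.fst, h.snd⟩ h', ?_⟩
    rintro rfl
    exact ⟨a, b, rfl, h.fst, h.snd⟩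
  have hno : ∀ {σ : Store ℕ}, SamplerState n A A σ → ∀ e : Sym2 (Fin n), σ ∉ returnsEdge e :=
    fun h e h' => not_returnsNoEdge h' h.result
  have hsome : ∀ {a b : Fin n} {σ : Store ℕ}, SamplerDone (A : ℝ) a b σ →
      (σ ∈ returnsSomeEdge Q ↔ Q.graph.Adj a b) := by
    intro a b σ h
    constructor
    · rintro ⟨e, he, h'⟩
      rwa [← (hdone h e).1 h'] at he
    · intro hab
      exact ⟨s(a, b), hab, (hdone h _).2 rfl⟩
  have hdeg : ∀ θ v, trialValue Q θ (fun a b => if Q.graph.Adj a b then 1 else 0) v =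
      successProb Q θ + failProb Q θ * v := by
    intro θ v
    rw [trialValue_eq, trialValue_zero, successProb]
    congr 2
    funext u
    rw [Finset.sum_congr rfl (fun w hw => if_pos ((Q.graph.mem_neighborFinset u w).1 hw))]
    simp [Q.deg_eq_card]
  have hpc : ∀ k < A, successProb Q ((A : ℝ) / (k + 1)) + failProb Q ((A : ℝ) / (k + 1)) = 1 :=
    fun k hk => sum_edgeWeight_add_failProb Q _ hn (one_le_threshold hk)
  have hgood : ∀ k < t, 40 * (Q.numEdges : ℝ) ≤ ((A : ℝ) / (k + 1)) ^ 2 :=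
    fun k hk => le_threshold_sq hm hk
  have hpos : ∀ k < t, (0 : ℝ) < (A : ℝ) / (k + 1) :=
    fun k hk => zero_lt_one.trans_le (one_le_threshold (hk.trans_le htA))
  -- Uses `2m ≤ n²` and `δ < 1`.
  have hδn : δ / (20 * (n : ℝ) ^ 2) ≤ 1 / 40 / Q.numEdges := by
    rw [div_div, div_le_div_iff₀ (by positivity) (by positivity)]
    nlinarith
  refine ⟨?_, ?_, fun e he => ?_⟩
  · obtain ⟨W, hWA, hW, hWeq⟩ := samplerLoop_value Q hn A
      (fun a b => if Q.graph.Adj a b then 1 else 0) 1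
      (f := (returnsSomeEdge Q ∪ returnsNoEdge).indicator 1)
      (fun σ h => by simp [Set.indicator, show σ ∈ returnsNoEdge from h.result])
      (fun a b σ h => by
        have : σ ∉ returnsNoEdge := not_returnsNoEdge ((hdone h _).2 rfl)
        simp [Set.indicator, hsome h, this])
    rw [hWeq 0 (by omega) σ' hσ']
    have : ∀ k ≤ A, W k = 1 := by
      intro k hk
      induction hk using Nat.decreasingInduction with
      | self => exact hWA
      | of_succ k hk ih => rw [hW k hk, hdeg, ih, mul_one, hpc k hk]
    exact this 0 (by omega)
  · obtain ⟨W, hWA, hW, hWeq⟩ := samplerLoop_value Q hn A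
      (fun a b => if Q.graph.Adj a b then 1 else 0) 0 (f := (returnsSomeEdge Q).indicator 1)
      (fun σ h => Set.indicator_of_notMem (by rintro ⟨e, _, h'⟩; exact hno h e h') _)
      (fun a b σ h => by simp [Set.indicator, hsome h])
    rw [hWeq 0 (by omega) σ' hσ']
    have h := le_add_of_recursion (κ := 1) t W (fun k => successProb Q ((A : ℝ) / (k + 1)))
      (fun k => successProb Q ((A : ℝ) / (k + 1))) (fun k => failProb Q ((A : ℝ) / (k + 1)))
      (fun k hk => by rw [hW k (hk.trans_le htA), hdeg]) (fun k hk => hpc k (hk.trans_le htA))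
      (fun k hk => by rw [one_mul])
    rw [one_mul] at h
    refine ofReal_one_sub_le (h.trans (add_le_add le_rfl hprod)) ?_ hδ.le
    exact div_le_self hδ.le (by nlinarith)
  · obtain ⟨W, hWA, hW, hWeq⟩ := samplerLoop_value Q hn A
      (fun a b => if s(a, b) = e then 1 else 0) 0 (f := (returnsEdge e).indicator 1)
      (fun σ h => Set.indicator_of_notMem (hno h e) _)
      (fun a b σ h => by simp [Set.indicator, hdone h])
    -- For the trials after the good ones it suffices that a probability is at most 1.
    have hle : W t ≤ 1 := by
      have : ∀ k ≤ A, W k ≤ 1 := by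
        intro k hk
        induction hk using Nat.decreasingInduction with
        | self => rw [hWA]; exact zero_le_one
        | of_succ k hk ih =>
          rw [hW k hk, trialValue_eq, trialValue_zero]
          refine le_trans ?_ (hpc k hk).le
          refine add_le_add (Finset.sum_le_sum fun u _ => ?_) (mul_le_of_le_one_right zero_le ih)
          gcongr
          calc _ ≤ ∑ w ∈ Q.graph.neighborFinset u, (1 : ℝ≥0∞) :=
                Finset.sum_le_sum fun w _ => by split_ifs <;> simp
            _ = Q.deg u := by simp [Q.deg_eq_card]
      exact this t htA
    rw [hWeq 0 (by omega) σ' hσ']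
    have hWk : ∀ k < t, W k = edgeProb Q ((A : ℝ) / (k + 1)) e +
        failProb Q ((A : ℝ) / (k + 1)) * W (k + 1) := fun k hk => by
      rw [hW k (hk.trans_le htA), trialValue_eq, trialValue_zero]
      rfl
    have hm0 : (Q.numEdges : ℝ≥0∞) ≠ 0 := by exact_mod_cast hm.ne'
    have hmt : (Q.numEdges : ℝ≥0∞) ≠ ⊤ := by simp
    constructor
    · have h := le_add_of_recursion (κ := ENNReal.ofReal (19 / 20 / Q.numEdges)) t W
        (fun k => edgeProb Q ((A : ℝ) / (k + 1)) e)
        (fun k => successProb Q ((A : ℝ) / (k + 1))) (fun k => failProb Q ((A : ℝ) / (k + 1)))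
        hWk (fun k hk => hpc k (hk.trans_le htA)) (fun k hk => by
          refine le_trans ?_ (le_edgeProb Q _ (hpos k hk) (hgood k hk) he)
          refine (mul_le_mul_right (successProb_le Q _) _).trans (le_of_eq ?_)
          rw [ENNReal.ofReal_div_of_pos (by positivity), ENNReal.ofReal_natCast,
            ENNReal.div_eq_inv_mul]
          calc _ = unitWeight n ((A : ℝ) / (k + 1)) * ENNReal.ofReal (19 / 20) * 2 *
                ((Q.numEdges : ℝ≥0∞)⁻¹ * Q.numEdges) := by ring
            _ = _ := by rw [ENNReal.inv_mul_cancel hm0 hmt, mul_one])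
      have h2 : ENNReal.ofReal (19 / 20 / Q.numEdges) ≤
          W 0 + ENNReal.ofReal (19 / 20 / Q.numEdges * (δ / (20 * n ^ 2))) := by
        rw [ENNReal.ofReal_mul (by positivity)]
        exact h.trans (by gcongr)
      have h3 : 19 / 20 / (Q.numEdges : ℝ) * (δ / (20 * n ^ 2)) ≤ 1 / 20 / Q.numEdges := by
        have h4 : δ / (20 * (n : ℝ) ^ 2) ≤ 1 / 40 :=
          hδn.trans (div_le_self (by norm_num) hm1)
        calc 19 / 20 / (Q.numEdges : ℝ) * (δ / (20 * n ^ 2)) ≤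
            19 / 20 / (Q.numEdges : ℝ) * (1 / 40) := by gcongr
          _ = 19 / 800 / Q.numEdges := by ring
          _ ≤ _ := div_le_div_of_nonneg_right (by norm_num) (by positivity)
      calc ENNReal.ofReal ((1 - 1 / 10) / Q.numEdges)
          = ENNReal.ofReal (19 / 20 / Q.numEdges) - ENNReal.ofReal (1 / 20 / Q.numEdges) := by
            rw [← ENNReal.ofReal_sub _ (by positivity)]
            congr 1
            ring
        _ ≤ W 0 := by
            rw [tsub_le_iff_right]
            exact h2.trans (by gcongr)
    · have h := recursion_le (κ := ENNReal.ofReal (20 / 19 / Q.numEdges)) t W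
        (fun k => edgeProb Q ((A : ℝ) / (k + 1)) e)
        (fun k => successProb Q ((A : ℝ) / (k + 1))) (fun k => failProb Q ((A : ℝ) / (k + 1)))
        hWk (fun k hk => hpc k (hk.trans_le htA)) (fun k hk => by
          refine (edgeProb_le Q _ he).trans ?_
          refine le_trans (le_of_eq ?_)
            (mul_le_mul_right (le_successProb Q _ (hpos k hk) (hgood k hk)) _)
          rw [ENNReal.ofReal_div_of_pos (by positivity), ENNReal.ofReal_natCast,
            ENNReal.div_eq_inv_mul]
          have h19 : ENNReal.ofReal (20 / 19) * ENNReal.ofReal (19 / 20) = 1 := by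
            rw [← ENNReal.ofReal_mul (by norm_num)]; norm_num
          calc _ = unitWeight n ((A : ℝ) / (k + 1)) * 2 *
                (ENNReal.ofReal (20 / 19) * ENNReal.ofReal (19 / 20)) *
                ((Q.numEdges : ℝ≥0∞)⁻¹ * Q.numEdges) := by
                rw [ENNReal.inv_mul_cancel hm0 hmt, mul_one, h19, mul_one]
            _ = _ := by ring)
      calc W 0 ≤ ENNReal.ofReal (20 / 19 / Q.numEdges) +
            ENNReal.ofReal (1 / 40 / Q.numEdges) * 1 :=
            h.trans (by gcongr; exact hprod.trans (ENNReal.ofReal_le_ofReal hδn))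
        _ = ENNReal.ofReal (20 / 19 / Q.numEdges + 1 / 40 / Q.numEdges) := by
            rw [mul_one, ENNReal.ofReal_add (by positivity) (by positivity)]
        _ ≤ _ := by
            refine ENNReal.ofReal_le_ofReal ?_
            rw [← add_div]
            exact div_le_div_of_nonneg_right (by norm_num) (by positivity)

/-! ### Running time of the sampler -/

theorem cast_log_two_lt_of_mul_pow_lt {x y : ℝ} {ℓ : ℕ} (hx : 0 < x) (h : x * 2 ^ ℓ < y) :
    ℓ * Real.log 2 < Real.log y + Real.log (1 / x) := by
  have hy : 0 < y := lt_trans (by positivity) h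
  have h1 := Real.log_lt_log (by positivity) h
  rw [Real.log_mul hx.ne' (by positivity), Real.log_pow] at h1
  rw [one_div, Real.log_inv]
  linarith

/-- Lets the factor `n / √m` absorb the additive costs of setting up and of the late trials. -/
theorem QueryGraph.one_le_div_sqrt {n : ℕ} (Q : QueryGraph n) (hm : 0 < Q.numEdges) :
    1 ≤ (n : ℝ) / √(Q.numEdges : ℝ) := by
  have hm1 : (1 : ℝ) ≤ Q.numEdges := by exact_mod_cast hm
  have hmn : 2 * (Q.numEdges : ℝ) ≤ (n : ℝ) ^ 2 := by exact_mod_cast Q.two_mul_numEdges_le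
  rw [one_le_div (Real.sqrt_pos.2 (by linarith))]
  exact Real.sqrt_le_iff.2 ⟨by positivity, by linarith⟩

/-- At most `t ≤ 160 * (n / √m) * L` good trials are paid in full. The up to `A` later ones are
reached with probability at most `δ / (20n²)` and cost only a multiple of `L` on average. -/
theorem edgeSampler_time {n : ℕ} (Q : QueryGraph n) {η δ : ℝ} {σ : Store ℕ}
    (hm : 0 < Q.numEdges) (hδ : 0 < δ) (hδ1 : δ < 1) (hσ : SamplerInput n η δ σ) :
    runCost Q 1 (fun _ => 0) [edgeSampler] σ ≤ ENNReal.ofReal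
      (70000 * (n / √(Q.numEdges : ℝ)) * (1 + Real.log n) * (1 + Real.log (1 / δ))) := by
  have hmn : 2 * (Q.numEdges : ℝ) ≤ (n : ℝ) ^ 2 := by exact_mod_cast Q.two_mul_numEdges_le
  have hn : 0 < n := by
    rcases Nat.eq_zero_or_pos n with rfl | h
    · have := Q.two_mul_numEdges_le
      omega
    · exact h
  have hn1 : (1 : ℝ) ≤ n := by exact_mod_cast hn
  have hm1 : (1 : ℝ) ≤ Q.numEdges := by exact_mod_cast hm
  obtain ⟨L, T, σ', hL, hLδ, hLδ2, hT, hσ', heq⟩ := edgeSampler_setup Q hn hδ hδ1 hσ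
  have hprod := prod_failProb_le Q hn hm hL hLδ
  have hL1 : (1 : ℝ) ≤ L := by exact_mod_cast hL
  have hX := Q.one_le_div_sqrt hm
  have ha : 0 ≤ Real.log n := Real.log_nonneg hn1
  have hb : 0 ≤ Real.log (1 / δ) := Real.log_nonneg (by rw [one_le_div hδ]; exact hδ1.le)
  have hLlog : (L : ℝ) ≤ 6 * (1 + Real.log n) * (1 + Real.log (1 / δ)) := by
    have h1 := cast_log_two_lt_of_mul_pow_lt hδ hLδ2
    rw [Real.log_mul (by norm_num) (by positivity), Real.log_pow] at h1
    have h2 : Real.log 40 ≤ 6 * Real.log 2 := by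
      have := Real.log_le_log (by norm_num) (show (40 : ℝ) ≤ 2 ^ 6 by norm_num)
      rw [Real.log_pow] at this
      exact_mod_cast this
    have h3 := Real.log_two_gt_d9
    have h4 : (L : ℝ) * Real.log 2 ≤ (6 + 3 * Real.log n + 3 / 2 * Real.log (1 / δ)) *
        Real.log 2 := by
      push_cast at h1
      nlinarith
    have h5 := le_of_mul_le_mul_right h4 (by linarith)
    nlinarith [mul_nonneg ha hb]
  rw [heq, mul_one]
  set A := 160 * n * L with hA
  set t := goodTrials A Q.numEdges with ht
  set X := (n : ℝ) / √(Q.numEdges : ℝ) with hXdef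
  have htA : t ≤ A := goodTrials_le hm
  obtain ⟨W, hWA, hW, hWle⟩ := samplerLoop_time Q hn A
  have hc : ∀ k < A, failProb Q ((A : ℝ) / (k + 1)) ≤ 1 := fun k hk =>
    failProb_le_one Q hn (one_le_threshold hk)
  have hWt : W t ≤ 63 * A + 2 := by
    have : ∀ k ≤ A, W k ≤ 63 * (A - k : ℕ) + 2 := by
      intro k hk
      induction hk using Nat.decreasingInduction with
      | self => rw [hWA]; simp
      | of_succ k hk ih =>
        rw [hW k hk]
        calc 63 + failProb Q ((A : ℝ) / (k + 1)) * W (k + 1)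
            ≤ 63 + 1 * (63 * (A - (k + 1) : ℕ) + 2) := by
              gcongr
              exact hc k hk
          _ = 63 * ((A - (k + 1) + 1 : ℕ) : ℝ≥0∞) + 2 := by push_cast; ring
          _ = _ := by rw [show A - (k + 1) + 1 = A - k by omega]
    refine (this t htA).trans ?_
    gcongr
    omega
  have h0 := time_recursion_le (B := 63) t W (fun k => failProb Q ((A : ℝ) / (k + 1)))
    (fun k hk => (hW k (hk.trans_le htA)).le) (fun k hk => hc k (hk.trans_le htA))
  have htX : (t : ℝ) ≤ 160 * X * L := by
    have h1 : (t : ℝ) ≤ (A : ℝ) / √(40 * Q.numEdges) := Nat.floor_le (by positivity)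
    refine h1.trans ?_
    have h2 : √(Q.numEdges : ℝ) ≤ √(40 * Q.numEdges) := Real.sqrt_le_sqrt (by linarith)
    calc (A : ℝ) / √(40 * Q.numEdges) ≤ A / √(Q.numEdges : ℝ) := by
          gcongr
      _ = _ := by rw [hA, hXdef]; push_cast; ring
  have hlast : δ / (20 * (n : ℝ) ^ 2) * (63 * A + 2) ≤ 600 * L := by
    rw [div_mul_eq_mul_div, div_le_iff₀ (by positivity), hA]
    push_cast
    have h1 : δ * (63 * (160 * n * L) + 2) ≤ 1 * (63 * (160 * n * L) + 2) := by gcongr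
    have h2 : (n : ℝ) ≤ (n : ℝ) ^ 2 := by nlinarith
    have h3 : (n : ℝ) * L ≤ n ^ 2 * L := by gcongr
    have h4 : 1 ≤ (n : ℝ) ^ 2 * L := by nlinarith
    nlinarith
  have hT' : (T : ℝ) ≤ 36 * L := by
    have : (T : ℝ) ≤ 30 + 6 * L := by exact_mod_cast hT
    linarith
  calc (T : ℝ≥0∞) + runCost Q 1 (fun _ => 0) [samplerLoop, .block []] σ'
      ≤ T + (t * 63 + ENNReal.ofReal (δ / (20 * n ^ 2)) * (63 * A + 2)) := by
        gcongr
        exact (hWle 0 (by omega) σ' hσ').trans (h0.trans (by gcongr))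
    _ = ENNReal.ofReal (T + (t * 63 + δ / (20 * n ^ 2) * (63 * A + 2))) := by
        rw [ENNReal.ofReal_add (by positivity) (by positivity), ENNReal.ofReal_add (by positivity)
          (by positivity), ENNReal.ofReal_mul (by positivity), ENNReal.ofReal_mul (by positivity),
          ENNReal.ofReal_add (by positivity) (by positivity), ENNReal.ofReal_mul (by positivity)]
        simp
    _ ≤ _ := by
        refine ENNReal.ofReal_le_ofReal ?_
        have h1 : (L : ℝ) ≤ X * L := le_mul_of_one_le_left (by linarith) hX
        have h2 : X * L ≤ X * (6 * (1 + Real.log n) * (1 + Real.log (1 / δ))) := by gcongr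
        linarith

theorem edgeSampler_complexity : SamplerComplexity edgeSampler (1 / 10) := by
  refine ⟨70000, 1, fun n Q δ σ hm hδ hδ1 hσ => ?_⟩
  have hm1 : (1 : ℝ) ≤ Q.numEdges := by exact_mod_cast hm
  have hn1 : 0 ≤ Real.log n := Real.log_natCast_nonneg n
  have hb : 0 ≤ Real.log (1 / δ) := Real.log_nonneg (by rw [one_le_div hδ]; exact hδ1.le)
  have h : expectedTime Q edgeSampler σ ≤ ENNReal.ofReal (70000 * (n / √(1 / 10 * Q.numEdges)) *
      (1 + Real.log n) ^ 1 * (1 + Real.log (1 / δ)) ^ 1) := by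
    rw [expectedTime_eq_runCost, pow_one, pow_one]
    refine (edgeSampler_time Q hm hδ hδ1 hσ).trans (ENNReal.ofReal_le_ofReal ?_)
    have : √(1 / 10 * (Q.numEdges : ℝ)) ≤ √(Q.numEdges : ℝ) := Real.sqrt_le_sqrt (by linarith)
    have h0 : 0 < √(1 / 10 * (Q.numEdges : ℝ)) := Real.sqrt_pos.2 (by positivity)
    gcongr
  exact ⟨(expectedQueries_le_expectedTime Q _ σ).trans h, h⟩

/-! ### Running time of Estimate-high-edges -/

theorem eheTail_time {n : ℕ} (Q : QueryGraph n) (σ : Store EheReg) :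
    runCost Q 1 (fun _ => 0) [eheTail] σ ≤ 30 := by
  have h : eheTail.LoopFree := by simp [eheTail, Prog.LoopFree, Prog.block]
  refine (h.time_le Q σ).trans ?_
  have : eheTail.size ≤ 30 := by simp [eheTail, Prog.size, Prog.block]
  exact_mod_cast this

theorem eheFinish_time {n : ℕ} (Q : QueryGraph n) (σ : Store EheReg) :
    runCost Q 1 (fun _ => 0) [eheFinish] σ ≤ 30 := by
  have h : eheFinish.LoopFree := by simp [eheFinish, Prog.LoopFree, Prog.block]
  refine (h.time_le Q σ).trans ?_
  have : eheFinish.size ≤ 30 := by simp [eheFinish, Prog.size, Prog.block]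
  exact_mod_cast this

/-- Either the state of the loop is restored with some count, or no edge was returned and `i = r`,
which ends the loop; a bound for the continuation in both cases suffices. -/
theorem EheState.tail {n : ℕ} {ε δ' thr : ℝ} {r i c : ℕ} {σ : Store EheReg}
    (h : EheState n ε δ' thr r i c σ) (Q : QueryGraph n) (F : Store EheReg → ℝ≥0∞) (B : ℝ≥0∞)
    (hF : ∀ c' σ', EheState n ε δ' thr r i c' σ' → F σ' ≤ B)
    (hF' : ∀ σ' : Store EheReg, σ' (reg .i) = σ' (reg .r) → F σ' ≤ B) :
    runCost Q 0 F [eheTail] σ ≤ B := by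
  obtain ⟨hn, hε, hδ', hthr, hz, ho, hr, hi, hc, hf⟩ := h
  simp only [eheTail, runCost_block_cons, runCost_ite, zero_add]
  split_ifs with h1
  · simp only [runCost_block_cons, runCost_block_nil, runCost_const, runCost_copy, runCost_nil,
      zero_add]
    exact hF' _ (by simp)
  · simp only [runCost_block_cons, runCost_degree, runCost_ite, zero_add]
    split_ifs with h2
    · rw [runCost_ite, zero_add]
      split_ifs with h3
      · simp only [runCost_block_nil, runCost_addInstr, runCost_nil, zero_add]
        refine hF (c + 1) _ ?_
        constructor <;> simp [*]
      · simp only [runCost_block_nil, runCost_skip, runCost_nil, zero_add]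
        refine hF c _ ?_
        constructor <;> simp [*]
    · simp only [runCost_block_nil, runCost_skip, runCost_nil, zero_add]
      refine hF c _ ?_
      constructor <;> simp [*]

/-- Each turn costs one step for the test, 9 before the call, at most `B` inside it and 30 after it;
31 is the final test with the closing part. -/
theorem ehe_loop_time {n : ℕ} {Q : QueryGraph n} {S : Prog ℕ} {ε δ' thr : ℝ} {r : ℕ} {B : ℝ≥0∞}
    (hB : ∀ s, SamplerInput n (1 / 10) δ' s → runCost Q 1 (fun _ => 0) [S] s ≤ B)
    (j i c : ℕ) (hij : i + j = r) (σ : Store EheReg) (hσ : EheState n ε δ' thr r i c σ) :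
    runCost Q 1 (fun _ => 0) [eheLoop S, eheFinish] σ ≤ j * (40 + B) + 31 := by
  have hexit : ∀ σ : Store EheReg, σ (reg .i) = σ (reg .r) →
      runCost Q 1 (fun _ => 0) [eheLoop S, eheFinish] σ ≤ 31 := by
    intro σ h
    rw [eheLoop, runCost_loop_neg _ _ _ _ _ (by simp [h])]
    calc _ ≤ (1 : ℝ≥0∞) + 30 := by gcongr; exact eheFinish_time Q σ
      _ = 31 := by norm_num
  induction j generalizing i c σ with
  | zero =>
    refine (hexit σ (by rw [hσ.i, hσ.r, ← hij]; simp)).trans ?_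
    exact le_add_self
  | succ j ih =>
    have hlt : σ (reg .i) < σ (reg .r) := by
      rw [hσ.i, hσ.r, ← hij]; push_cast; linarith
    obtain ⟨s, v, hs, hv, heq⟩ := hσ.call Q S 1 (fun _ => 0) [eheLoop S, eheFinish]
    rw [eheLoop] at heq
    rw [eheLoop, runCost_loop_pos _ _ _ _ _ hlt, heq, ← eheLoop, runCost_eq_time_add Q 1 _ [S]]
    have htail : ∀ s', runCost Q 1 (fun _ => 0) [eheTail, eheLoop S, eheFinish] (Sum.elim s' v) ≤
        30 + (j * (40 + B) + 31) := by
      intro s'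
      rw [runCost_cons_eq, runCost_eq_time_add]
      gcongr
      · exact eheTail_time Q _
      · refine (hv s').tail Q _ _ (fun c' σ' hσ' => ih (i + 1) c' (by omega) σ' hσ')
          fun σ' h => (hexit σ' h).trans le_add_self
    calc 1 + (9 * 1 + (runCost Q 1 (fun _ => 0) [S] s + runCost Q 0 (fun s' =>
          runCost Q 1 (fun _ => 0) [eheTail, eheLoop S, eheFinish] (Sum.elim s' v)) [S] s))
        ≤ 1 + (9 * 1 + (B + (30 + (j * (40 + B) + 31)))) := by
          gcongr
          · exact hB s hs
          · exact runCost_zero_le Q htail _ _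
      _ = _ := by push_cast; ring

/-- The number of samples contributes `(1 + log (1/δ)) / ε`. The factor `1 + log (1/ε)` comes from
calling the sampler with `δ' = δ / (2r)`, since `log (1/δ')` contains `log (2r)`; this also produces
the second power of `1 + log (1/δ)`. -/
theorem ehe_time {n : ℕ} (Q : QueryGraph n) {α ε δ : ℝ} {σ : Store EheReg}
    (hm : 0 < Q.numEdges) (hε : 0 < ε) (hε1 : ε < 1) (hδ : 0 < δ) (hδ1 : δ < 1)
    (hσ : EheInput n α ε δ σ) :
    expectedTime Q (estimateHighEdges edgeSampler) σ ≤ ENNReal.ofReal (300000000 *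
      ((n / √(Q.numEdges : ℝ)) * ((1 + Real.log (1 / ε)) / ε)) * (1 + Real.log n) ^ 2 *
        (1 + Real.log (1 / δ)) ^ 2) := by
  obtain ⟨ℓ, r, T, σ', hℓ, -, hℓ4, hr, hr1, hr2, hT, hσ', heq⟩ := ehe_setup Q edgeSampler hε hδ hδ1 hσ
  have hrpos : (1 : ℝ) ≤ r := by exact_mod_cast hr
  have hℓpos : (1 : ℝ) ≤ ℓ := by exact_mod_cast hℓ
  have hX := Q.one_le_div_sqrt hm
  have hδ'0 : 0 < δ / (2 * r) := by positivity
  have hδ'1 : δ / (2 * r) < 1 := by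
    rw [div_lt_one (by positivity)]; linarith
  have ha : 0 ≤ Real.log n := Real.log_natCast_nonneg n
  have hb : 0 ≤ Real.log (1 / δ) := Real.log_nonneg (by rw [one_le_div hδ]; exact hδ1.le)
  have he : 0 ≤ Real.log (1 / ε) := Real.log_nonneg (by rw [one_le_div hε]; exact hε1.le)
  have hlog2 := Real.log_two_gt_d9
  have hlog2' := Real.log_two_lt_d9
  have hloop := ehe_loop_time (fun s hs => edgeSampler_time Q hm hδ'0 hδ'1 hs) r 0 0 (by simp)
    σ' hσ'
  have hlogδ' : Real.log (1 / (δ / (2 * r))) = Real.log (2 * r) + Real.log (1 / δ) := by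
    rw [one_div_div, ← Real.log_mul (by positivity) (by positivity)]
    congr 1
    ring
  have hℓb : (ℓ : ℝ) ≤ 2 * (1 + Real.log (1 / δ)) := by
    have h1 := cast_log_two_lt_of_mul_pow_lt hδ hℓ4
    have h2 : Real.log 4 = 2 * Real.log 2 := by
      rw [show (4 : ℝ) = 2 ^ 2 by norm_num, Real.log_pow]; norm_num
    have h4 : (ℓ : ℝ) * Real.log 2 ≤ (2 * (1 + Real.log (1 / δ))) * Real.log 2 := by nlinarith
    exact le_of_mul_le_mul_right h4 (by linarith)
  have hrb : (r : ℝ) ≤ 202 * (1 + Real.log (1 / δ)) / ε := by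
    rw [le_div_iff₀ hε]
    linarith
  rw [hlogδ'] at hloop
  set X := (n : ℝ) / √(Q.numEdges : ℝ)
  set a := Real.log n
  set b := Real.log (1 / δ)
  set e := Real.log (1 / ε)
  have hlogr : Real.log (2 * r) ≤ 7 + b + e := by
    have h1 : 2 * (r : ℝ) ≤ 2 ^ 9 * (1 + b) * (1 / ε) := by
      have : 202 * (1 + b) / ε = 202 * ((1 + b) * (1 / ε)) := by ring
      rw [this] at hrb
      have h2 : 0 ≤ (1 + b) * (1 / ε) := by positivity
      linarith
    have h2 := Real.log_le_log (by positivity) h1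
    rw [Real.log_mul (x := 2 ^ 9 * (1 + b)) (by positivity) (by positivity),
      Real.log_mul (x := 2 ^ 9) (by positivity) (by positivity), Real.log_pow] at h2
    have h3 := Real.log_le_sub_one_of_pos (show 0 < 1 + b by linarith)
    push_cast at h2
    linarith
  have hfac : 1 + (Real.log (2 * r) + b) ≤ 8 * (1 + b) * (1 + e) := by
    nlinarith [mul_nonneg hb he]
  have hlr : 0 ≤ Real.log (2 * r) := Real.log_nonneg (by linarith)
  rw [expectedTime_eq_runCost, heq, mul_one]
  calc (T : ℝ≥0∞) + runCost Q 1 (fun _ => 0) [eheLoop edgeSampler, eheFinish] σ'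
      ≤ T + (r * (40 + ENNReal.ofReal (70000 * X * (1 + a) *
          (1 + (Real.log (2 * r) + b)))) + 31) := by gcongr
    _ = ENNReal.ofReal (T + (r * (40 + 70000 * X * (1 + a) *
          (1 + (Real.log (2 * r) + b))) + 31)) := by
        rw [ENNReal.ofReal_add (by positivity) (by positivity),
          ENNReal.ofReal_add (by positivity) (by positivity), ENNReal.ofReal_mul (p := (r : ℝ)) (by positivity),
          ENNReal.ofReal_add (p := 40) (by positivity) (by positivity)]
        simp
    _ ≤ _ := by
        refine ENNReal.ofReal_le_ofReal ?_
        have hT' : (T : ℝ) ≤ 60 + 6 * ℓ + 6 * r := by exact_mod_cast hT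
        have hℓr : (ℓ : ℝ) ≤ r := by nlinarith
        set Y := X * (1 + a) * ((1 + b) * (1 + e)) with hY
        have hY1 : 1 ≤ Y := by
          have h1 : 1 ≤ X * (1 + a) := one_le_mul_of_one_le_of_one_le hX (by linarith)
          have h2 : 1 ≤ (1 + b) * (1 + e) :=
            one_le_mul_of_one_le_of_one_le (by linarith) (by linarith)
          exact one_le_mul_of_one_le_of_one_le h1 h2
        have h1 : 70000 * X * (1 + a) * (1 + (Real.log (2 * r) + b)) ≤ 560000 * Y := by
          calc _ ≤ 70000 * X * (1 + a) * (8 * (1 + b) * (1 + e)) := by gcongr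
            _ = _ := by rw [hY]; ring
        have h2 : (T : ℝ) + (r * (40 + 70000 * X * (1 + a) * (1 + (Real.log (2 * r) + b))) + 31) ≤
            r * (600000 * Y) := by
          have h3 : (r : ℝ) * (40 + 70000 * X * (1 + a) * (1 + (Real.log (2 * r) + b))) ≤
              r * (40 + 560000 * Y) := by gcongr
          have h4 : (r : ℝ) ≤ r * Y := le_mul_of_one_le_right (by linarith) hY1
          linarith
        refine h2.trans ?_
        have hY0 : 0 ≤ Y := by linarith
        calc (r : ℝ) * (600000 * Y) ≤ 202 * (1 + b) / ε * (600000 * Y) := by gcongr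
          _ = 121200000 * (X * ((1 + e) / ε)) * ((1 + a) * 1) * (1 + b) ^ 2 := by rw [hY]; ring
          -- One factor `1 + a` would do; it is squared only because both logarithms share the
          -- exponent `k = 2`.
          _ ≤ 300000000 * (X * ((1 + e) / ε)) * ((1 + a) * (1 + a)) * (1 + b) ^ 2 := by
            gcongr
            · norm_num
            · linarith
          _ = _ := by ring

end

/-- First part: with any procedure `S` that samples edges almost uniformly (accuracy `0.1`),
Estimate-high-edges returns MANY or FEW, and each is the answer with probability at least `1 - δ`
when it should be. Second part: such procedures exist, within the stated complexity of almost
uniform edge sampling, and with one of them the expected query complexity and running time of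
Estimate-high-edges are `Õ((n/√m) · log(1/ε)/ε) · polylog(1/δ)`. -/
theorem mainTheorem4 :
    (∀ S : Prog ℕ, SamplesAlmostUniformly S (1 / 10) →
      ∀ (n : ℕ) (Q : QueryGraph n) (α ε δ : ℝ) (σ : Store EheReg),
        0 < Q.numEdges → 0 < ε → ε < 1 → 0 < δ → δ < 1 → EheInput n α ε δ σ →
          haltProb Q (estimateHighEdges S) σ (answersMany ∪ answersFew) = 1 ∧
          (4 * ε * Q.numEdges < (Q.numHighEdges α ε : ℝ) →
            ENNReal.ofReal (1 - δ) ≤ haltProb Q (estimateHighEdges S) σ answersMany) ∧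
          ((Q.numHighEdges α ε : ℝ) ≤ 2 * ε * Q.numEdges →
            ENNReal.ofReal (1 - δ) ≤ haltProb Q (estimateHighEdges S) σ answersFew)) ∧
    (∃ S : Prog ℕ, SamplesAlmostUniformly S (1 / 10) ∧ SamplerComplexity S (1 / 10) ∧
      ∃ (C : ℝ) (k : ℕ),
        ∀ (n : ℕ) (Q : QueryGraph n) (α ε δ : ℝ) (σ : Store EheReg),
          0 < Q.numEdges → 0 < ε → ε < 1 → 0 < δ → δ < 1 → EheInput n α ε δ σ →
            let bound := ENNReal.ofReal (C * ((n / √(Q.numEdges : ℝ)) *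
              ((1 + Real.log (1 / ε)) / ε)) * (1 + Real.log n) ^ k *
                (1 + Real.log (1 / δ)) ^ k)
            expectedQueries Q (estimateHighEdges S) σ ≤ bound ∧
            expectedTime Q (estimateHighEdges S) σ ≤ bound) := by
  refine ⟨fun S hS n Q α ε δ σ hm hε _ hδ hδ1 hσ => ehe_correct hS hm hε hδ hδ1 hσ,
    edgeSampler, edgeSampler_correct, edgeSampler_complexity, 300000000, 2,
    fun n Q α ε δ σ hm hε hε1 hδ hδ1 hσ => ?_⟩
  have h := ehe_time Q hm hε hε1 hδ hδ1 hσ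
  exact ⟨(expectedQueries_le_expectedTime Q _ σ).trans h, h⟩
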